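/- Let $d,\delta\ge 1$ and $D=d+\delta$. Let $\mathcal U\subset\{-1,0,1\}^d\setminus\{0^d\}$, $\mathcal V\subset\{-1,0,1\}^d$ and $\mathcal T\subset\{-1,0,1\}^\delta\setminus\{0^\delta\}$ be sets of steps (where $0^i$ denotes the $i$-tuple $(0,\dots,0)$), and let $$\mathcal S=\left(\mathcal U\times\{0^\delta\}\right)\cup\left(\mathcal V\times\mathcal T\right)\subset\{-1,0,1\}^D\setminus\{0^D\}$$ (such a step set is called $(d,\delta)$-Hadamard). All walks below start from the origin. Consider the following generating functions. * $O(x_1,\dots,x_D;t)$ counts walks with steps in $\mathcal S$ confined to $\mathbb N^D$, by the length (variable $t$) and the coordinates of the endpoint (variables $x_1,\dots,x_D$). * $C_1(x_1,\dots,x_d,v;t)$ counts coloured $(\mathcal U,\mathcal V)$-walks confined to $\mathbb N^d$, that is, walks with steps in $\mathcal U\cup\mathcal V$ in which each step is coloured black or white, all steps of $\mathcal U\setminus\mathcal V$ being white and all steps of $\mathcal V\setminus\mathcal U$ being black. They are counted by the length ($t$), the coordinates of the endpoint ($x_1,\dots,x_d$) and the number of black steps ($v$). * $C_2(x_{d+1},\dots,x_D;v)$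 counts walks with steps in $\mathcal T$ confined to $\mathbb N^\delta$, by the length ($v$) and the coordinates of the endpoint ($x_{d+1},\dots,x_D$). Then $$O(x_1,\dots,x_D;t)=\left.C_1(x_1,\dots,x_d,v;t)\odot_v C_2(x_{d+1},\dots,x_D;v)\right|_{v=1},$$ where $\odot_v$ is the Hadamard product with respect to $v$, defined by $\sum_i a_iv^i\odot_v\sum_j b_jv^j=\sum_i a_ib_iv^i$, and where the specialisation at $v=1$ is well defined: for each monomial in $x_1,\dots,x_D,t$, only finitely many powers of $v$ occur with it in the Hadamard product. In particular, if $C_1$ and $C_2$ are D-finite in all their variables, then $O$ is D-finite in all its variables. Here a power series $F\in\mathbb Q[[z_1,\dots,z_r]]$ is D-finite in all its variables if, for each $i$, the vector space over $\mathbb Q(z_1,\dots,z_r)$ spanned by the iterated derivatives $\partial_{z_i}^mF$, $m\ge 0$, has finite dimension. -/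

import Mathlib

/-! ### D-finite power series in several variables -/

/-- The vector space over the field `ℚ(σ)` of rational functions that is obtained from the space
of power series `ℚ⟦σ⟧` by allowing rational functions as coefficients, that is, by inverting the
non-zero polynomials; `ℚ⟦σ⟧` embeds in it (see `toRatSpan_injective`). -/
abbrev RatSpan (σ : Type) : Type :=
  LocalizedModule (nonZeroDivisors (MvPolynomial σ ℚ)) (MvPowerSeries σ ℚ)

/-- The canonical embedding of power series in `RatSpan σ`. -/
noncomputable def toRatSpan (σ : Type) (F : MvPowerSeries σ ℚ) : RatSpan σ :=
  LocalizedModule.mkLinearMap (nonZeroDivisors (MvPolynomial σ ℚ)) (MvPowerSeries σ ℚ) F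

theorem toRatSpan_injective (σ : Type) : Function.Injective (toRatSpan σ) := by
  intro F G h
  obtain ⟨c, hc⟩ := (IsLocalizedModule.eq_iff_exists (nonZeroDivisors (MvPolynomial σ ℚ))
    (LocalizedModule.mkLinearMap (nonZeroDivisors (MvPolynomial σ ℚ)) (MvPowerSeries σ ℚ))).1 h
  have hc' : ((c : MvPolynomial σ ℚ) : MvPowerSeries σ ℚ) * F
      = ((c : MvPolynomial σ ℚ) : MvPowerSeries σ ℚ) * G := by
    simpa [Submonoid.smul_def, Algebra.smul_def, MvPowerSeries.algebraMap_apply'] using hc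
  refine mul_left_cancel₀ ?_ hc'
  intro h0
  simp at h0

/-- `F` is D-finite with respect to the variable `i`: the vector space over the field `ℚ(σ)` of
rational functions spanned by the iterated derivatives `∂ᵢᵐ F` has finite dimension. -/
def IsDFiniteIn {σ : Type} (i : σ) (F : MvPowerSeries σ ℚ) : Prop :=
  FiniteDimensional (FractionRing (MvPolynomial σ ℚ))
    (Submodule.span (FractionRing (MvPolynomial σ ℚ))
      (Set.range fun m : ℕ => toRatSpan σ ((MvPowerSeries.pderiv ℚ i)^[m] F)))

/-- `F` is D-finite in all its variables: it is D-finite with respect to each of them. -/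
def IsDFinite {σ : Type} (F : MvPowerSeries σ ℚ) : Prop :=
  ∀ i : σ, IsDFiniteIn i F

/-! ### Walks confined to an orthant -/

/-- A walk that starts from the origin is given by its list of steps. It is an `S`-walk confined
to `ℕ^n` if its steps are in `S` and if all points that it visits have non-negative coordinates. -/
def IsOrthantWalk {n : ℕ} (S : Finset (Fin n → ℤ)) (w : List (Fin n → ℤ)) : Prop :=
  (∀ s ∈ w, s ∈ S) ∧ ∀ p : List (Fin n → ℤ), p <+: w → ∀ i, 0 ≤ p.sum i

/-- A coloured `(U, V)`-walk confined to `ℕ^n`: the steps are in `U ∪ V`, each is coloured (`true`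
is black, `false` is white), those of `U \ V` are white and those of `V \ U` are black. -/
def IsColouredWalk {n : ℕ} (U V : Finset (Fin n → ℤ)) (w : List ((Fin n → ℤ) × Bool)) : Prop :=
  IsOrthantWalk (U ∪ V) (w.map Prod.fst) ∧
    ∀ s ∈ w, (s.1 ∈ U \ V → s.2 = false) ∧ (s.1 ∈ V \ U → s.2 = true)

/-- The generating function of `S`-walks confined to `ℕ^n`, counted by the length (variable
`none`) and the coordinates of the endpoint (variables `some i`). -/
noncomputable def walkSeries {n : ℕ} (S : Finset (Fin n → ℤ)) :
    MvPowerSeries (Option (Fin n)) ℚ :=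
  fun m => (Set.ncard {w : List (Fin n → ℤ) |
    IsOrthantWalk S w ∧ w.length = m none ∧ ∀ i, w.sum i = m (some i)} : ℚ)

/-- The generating function of coloured `(U, V)`-walks confined to `ℕ^n`, counted by the number
of black steps (variable `none`, called `v`), the length (variable `some none`, called `t`) and
the coordinates of the endpoint (variables `some (some i)`). -/
noncomputable def colouredSeries {n : ℕ} (U V : Finset (Fin n → ℤ)) :
    MvPowerSeries (Option (Option (Fin n))) ℚ :=
  fun m => (Set.ncard {w : List ((Fin n → ℤ) × Bool) |
    IsColouredWalk U V w ∧ w.countP Prod.snd = m none ∧ w.length = m (some none) ∧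
      ∀ i, (w.map Prod.fst).sum i = m (some (some i))} : ℚ)

/-- The sets of walks that are counted above are finite. -/
theorem finite_walks {α : Type} (A : Finset α) (n : ℕ) :
    {w : List α | (∀ s ∈ w, s ∈ A) ∧ w.length = n}.Finite := by
  refine ((List.finite_length_eq A n).image (List.map Subtype.val)).subset ?_
  rintro w ⟨hA, hn⟩
  exact ⟨w.attachWith (· ∈ A) hA, by simpa using hn, by simp⟩

/-! ### Hadamard models -/

/-- `S` is `(d, δ)`-Hadamard, given by `S = (U × {0^δ}) ∪ (V × T)`, where `U`, `V` and `T` are sets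
of small steps, and `U` and `T` do not contain the zero step. -/
structure IsHadamardModel {d δ : ℕ} (S : Finset (Fin (d + δ) → ℤ)) (U V : Finset (Fin d → ℤ))
    (T : Finset (Fin δ → ℤ)) : Prop where
  d_pos : 0 < d
  delta_pos : 0 < δ
  small_U : ∀ s ∈ U, ∀ i, s i ∈ ({-1, 0, 1} : Set ℤ)
  small_V : ∀ s ∈ V, ∀ i, s i ∈ ({-1, 0, 1} : Set ℤ)
  small_T : ∀ s ∈ T, ∀ i, s i ∈ ({-1, 0, 1} : Set ℤ)
  zero_notMem_U : 0 ∉ U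
  zero_notMem_T : 0 ∉ T
  eq_union : S = Finset.image₂ Fin.append U {0} ∪ Finset.image₂ Fin.append V T

/-! ### Hadamard products -/

/-- The Hadamard product `∑ aₖ vᵏ ⊙ ∑ bₖ vᵏ = ∑ aₖ bₖ vᵏ` of two power series in one variable `v`
with coefficients in a ring. -/
noncomputable def hadamardProd {R : Type} [CommRing R] (F G : PowerSeries R) : PowerSeries R :=
  PowerSeries.mk fun k => PowerSeries.coeff k F * PowerSeries.coeff k G

/-- A series `∑ aₖ vᵏ` whose coefficients are power series can be specialised to `v = 1` if each
monomial occurs in only finitely many of the `aₖ`. -/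
def CanSpecialiseAtOne {σ : Type} (F : PowerSeries (MvPowerSeries σ ℚ)) : Prop :=
  ∀ m : σ →₀ ℕ, {k : ℕ | MvPowerSeries.coeff m (PowerSeries.coeff k F) ≠ 0}.Finite

/-- The specialisation `∑ aₖ` of `∑ aₖ vᵏ` to `v = 1`, computed monomial by monomial (to be used
under `CanSpecialiseAtOne`, which makes all the sums finite). -/
noncomputable def specialiseAtOne {σ : Type} (F : PowerSeries (MvPowerSeries σ ℚ)) :
    MvPowerSeries σ ℚ :=
  fun m => ∑ᶠ k : ℕ, MvPowerSeries.coeff m (PowerSeries.coeff k F)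

/-- The series `C₁(x₁, …, x_d, v; t)`, written as a power series in `v` with coefficients in
`ℚ⟦x₁, …, x_{d+δ}, t⟧`. -/
noncomputable def colouredSeriesInV {d : ℕ} (δ : ℕ) (U V : Finset (Fin d → ℤ)) :
    PowerSeries (MvPowerSeries (Option (Fin (d + δ))) ℚ) :=
  PowerSeries.map
    (MvPowerSeries.rename (R := ℚ) (Fin.castAddEmb (n := d) δ).optionMap).toRingHom
    (MvPowerSeries.optionEquivLeft (Option (Fin d)) ℚ (colouredSeries U V))

/-- The series `C₂(x_{d+1}, …, x_{d+δ}; v)`, written as a power series in `v` (the variable that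
counts the length) with coefficients in `ℚ⟦x₁, …, x_{d+δ}, t⟧`. -/
noncomputable def walkSeriesInV (d : ℕ) {δ : ℕ} (T : Finset (Fin δ → ℤ)) :
    PowerSeries (MvPowerSeries (Option (Fin (d + δ))) ℚ) :=
  PowerSeries.map
    (MvPowerSeries.rename (R := ℚ)
      ((Fin.natAddEmb (m := δ) d).trans Function.Embedding.some)).toRingHom
    (MvPowerSeries.optionEquivLeft (Fin δ) ℚ (walkSeries T))

/-! Projecting a Hadamard walk to its two blocks of coordinates gives two walks. The first `d`
coordinates give a walk of the same length, in which a step is black when the last `δ` coordinates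
move. The non-zero moves of the last `δ` coordinates give a `T`-walk, whose length is the number of
black steps. As `0 ∉ T`, the colours tell which steps carry a move, so this is a bijection
(`ncard_walks`). Confinement splits along the two blocks (`confined_iff`). Summing over the number
of black steps, which is at most the length, gives the formula.

For D-finiteness, let the coloured series keep `v` and let the other series use a copy `w`. The
Hadamard product is then the diagonal in `v`, `w` of the product `F G` of the two series
(`optionEquivLeft_diag`), and the diagonal is handled by counting differential operators, in the
manner of Lipshitz. Let `C` be the ring of polynomials in `v w` and the variables other than `v`,
`w`; let `D` be the derivative in such a variable and `E = v w ∂_v - w² ∂_w`, which kills `C`.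
Polynomials are combinations over `C` of the powers of `v` and `w`, and there are only `2n + 1` such
powers up to degree `n`. Up to a common denominator, the `M²` series `Eᵇ Dᵃ (w F G)` with `a, b < M`
thus lie in a `C`-module with `O(M)` generators, so they satisfy a non-trivial relation over `C`
(`exists_relation`).

The map `residue` keeps the monomials in which `w` has one more power than `v`. It sends `w F G` to
the diagonal, kills the image of `E`, commutes with `D` and turns `v w` into the diagonal variable.
Isolating the lowest power of `E` in the relation and taking residues leaves a differential equation
for the diagonal (`isDFiniteIn_diag_mul`). The diagonal variable itself needs no equation, since it
is then set to `1`; factors `v - 1` common to all coefficients are divided out first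
(`isDFiniteIn_atOne`).

Throughout, coefficients stay polynomial, and `saturation` plays the role of the span over rational
functions. -/

/-! ### Saturation of submodules and derivations -/

section Saturation

variable {P A : Type*} [CommRing P] [IsDomain P] [CommRing A] [Algebra P A]

/-- The elements that have a non-zero multiple in `N`. -/
def Submodule.saturation (N : Submodule P A) : Submodule P A where
  carrier := {x | ∃ q : P, q ≠ 0 ∧ q • x ∈ N}
  zero_mem' := ⟨1, one_ne_zero, by simp⟩
  add_mem' := by
    rintro x y ⟨p, hp, hx⟩ ⟨q, hq, hy⟩
    refine ⟨p * q, mul_ne_zero hp hq, ?_⟩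
    rw [smul_add]
    refine N.add_mem ?_ ?_
    · rw [mul_comm, mul_smul]
      exact N.smul_mem _ hx
    · rw [mul_smul]
      exact N.smul_mem _ hy
  smul_mem' := by
    rintro c x ⟨p, hp, hx⟩
    exact ⟨p, hp, by rw [smul_comm]; exact N.smul_mem _ hx⟩

theorem Submodule.le_saturation (N : Submodule P A) : N ≤ N.saturation :=
  fun x hx => ⟨1, one_ne_zero, by simpa using hx⟩

theorem Submodule.saturation_le {N M : Submodule P A} (h : N ≤ M.saturation) :
    N.saturation ≤ M.saturation := by
  rintro x ⟨p, hp, hx⟩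
  obtain ⟨q, hq, hqx⟩ := h hx
  exact ⟨q * p, mul_ne_zero hq hp, by rwa [mul_smul]⟩

theorem Submodule.saturation_mono {N M : Submodule P A} (h : N ≤ M) :
    N.saturation ≤ M.saturation :=
  saturation_le (h.trans M.le_saturation)

/-- A common denominator for finitely many elements of the saturation. -/
theorem Submodule.exists_common_denominator {N : Submodule P A} (s : Finset A)
    (h : ∀ x ∈ s, x ∈ N.saturation) : ∃ q : P, q ≠ 0 ∧ ∀ x ∈ s, q • x ∈ N := by
  classical
  induction s using Finset.induction_on with
  | empty => exact ⟨1, one_ne_zero, by simp⟩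
  | insert a s ha ih =>
    obtain ⟨q, hq, hs⟩ := ih fun x hx => h x (Finset.mem_insert_of_mem hx)
    obtain ⟨p, hp, hpa⟩ := h a (Finset.mem_insert_self _ _)
    refine ⟨p * q, mul_ne_zero hp hq, fun x hx => ?_⟩
    rcases Finset.mem_insert.1 hx with rfl | hx
    · rw [mul_comm, mul_smul]
      exact N.smul_mem _ hpa
    · rw [mul_smul]
      exact N.smul_mem _ (hs x hx)

variable {k : Type*} [CommRing k] [Algebra k A]

/-- The derivation `D` of the `P`-algebra `A` maps the image of `P` to itself. -/
def Derivation.Preserves (P : Type*) [CommRing P] [Algebra P A] (D : Derivation k A A) : Prop :=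
  ∀ p : P, ∃ p' : P, D (algebraMap P A p) = algebraMap P A p'

omit [IsDomain P] in
theorem Derivation.map_smul_of_eq {D : Derivation k A A} {p p' : P}
    (h : D (algebraMap P A p) = algebraMap P A p') (x : A) : D (p • x) = p' • x + p • D x := by
  rw [Algebra.smul_def, D.leibniz, h, smul_eq_mul, smul_eq_mul, Algebra.smul_def, Algebra.smul_def]
  ring

/-- If `q x` lies in `N`, then `q D x = D (q x) - (D q) x`, and both terms on the right lie in the
saturation of `M`. -/
theorem Derivation.map_saturation {D : Derivation k A A} (hD : D.Preserves P)
    {N M : Submodule P A} (hNM : N ≤ M.saturation) (h : ∀ x ∈ N, D x ∈ M.saturation) {x : A}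
    (hx : x ∈ N.saturation) : D x ∈ M.saturation := by
  have hxM := Submodule.saturation_le hNM hx
  obtain ⟨q, hq, hqx⟩ := hx
  obtain ⟨q', hq'⟩ := hD q
  have h1 : q • D x ∈ M.saturation := by
    have h2 := M.saturation.sub_mem (h _ hqx) (M.saturation.smul_mem q' hxM)
    rwa [D.map_smul_of_eq hq', add_sub_cancel_left] at h2
  obtain ⟨p, hp, hpx⟩ := h1
  exact ⟨p * q, mul_ne_zero hp hq, by rwa [mul_smul]⟩

theorem Derivation.map_mem_of_span {D : Derivation k A A} (hD : D.Preserves P)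
    {s : Set A} {M : Submodule P A} (hs : s ⊆ M.saturation) (h : ∀ x ∈ s, D x ∈ M.saturation)
    {x : A} (hx : x ∈ Submodule.span P s) : D x ∈ M.saturation := by
  induction hx using Submodule.span_induction with
  | mem x hx => exact h x hx
  | zero => simp
  | add x y _ _ hx hy => rw [map_add]; exact add_mem hx hy
  | smul p x hxs hx =>
    obtain ⟨p', hp'⟩ := hD p
    rw [D.map_smul_of_eq hp']
    exact add_mem (Submodule.smul_mem _ _ ((Submodule.span_le.2 hs) hxs))
      (Submodule.smul_mem _ _ hx)

/-- The saturation of the span of `s` is stable under `D` if the derivatives of elements of `s`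
belong to it. -/
theorem Derivation.map_saturation_span {D : Derivation k A A} (hD : D.Preserves P)
    {s : Set A} {M : Submodule P A} (hs : s ⊆ M.saturation) (h : ∀ x ∈ s, D x ∈ M.saturation)
    {x : A} (hx : x ∈ (Submodule.span P s).saturation) : D x ∈ M.saturation :=
  D.map_saturation hD (Submodule.span_le.2 hs) (fun _ hx => D.map_mem_of_span hD hs h hx) hx

theorem Derivation.iterate_mem_saturation {D : Derivation k A A} (hD : D.Preserves P)
    {s : Set A} {x : A} (hx : x ∈ (Submodule.span P s).saturation) (n : ℕ) :
    D^[n] x ∈ (Submodule.span P {y | ∃ m ≤ n, ∃ z ∈ s, y = D^[m] z}).saturation := by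
  induction n with
  | zero =>
    refine Submodule.saturation_mono (Submodule.span_mono fun z hz => ?_) hx
    exact ⟨0, le_rfl, z, hz, rfl⟩
  | succ n ih =>
    rw [Function.iterate_succ_apply']
    refine D.map_saturation_span hD ?_ ?_ ih
    · rintro y ⟨m, hm, z, hz, rfl⟩
      exact Submodule.le_saturation _ (Submodule.subset_span ⟨m, by omega, z, hz, rfl⟩)
    · rintro y ⟨m, hm, z, hz, rfl⟩
      refine Submodule.le_saturation _ (Submodule.subset_span ⟨m + 1, by omega, z, hz, ?_⟩)
      rw [Function.iterate_succ_apply']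

/-- `f` is D-finite of order at most `r` for the derivation `D`. -/
def Derivation.FiniteOrder (P : Type*) [CommRing P] [IsDomain P] [Algebra P A]
    (D : Derivation k A A) (f : A) (r : ℕ) : Prop :=
  ∀ n, D^[n] f ∈ (Submodule.span P ((fun m => D^[m] f) '' Set.Iio r)).saturation

/-- Once the derivative of order `r` reduces to lower ones, so do all later ones. The hypothesis
`h0` has content only for `r = 0`, where the span is zero. -/
theorem Derivation.finiteOrder_of_mem {D : Derivation k A A} (hD : D.Preserves P) {f : A} {r : ℕ}
    (h0 : f ∈ (Submodule.span P ((fun m => D^[m] f) '' Set.Iio r)).saturation)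
    (h : D^[r] f ∈ (Submodule.span P ((fun m => D^[m] f) '' Set.Iio r)).saturation) :
    D.FiniteOrder P f r := by
  intro n
  induction n with
  | zero => exact h0
  | succ n ih =>
    rw [Function.iterate_succ_apply']
    refine D.map_saturation_span hD ?_ ?_ ih
    · rintro _ ⟨m, hm, rfl⟩
      exact Submodule.le_saturation _ (Submodule.subset_span ⟨m, hm, rfl⟩)
    · rintro _ ⟨m, hm, rfl⟩
      simp only [← Function.iterate_succ_apply' D m f]
      rcases Nat.lt_or_ge (m + 1) r with h1 | h1
      · exact Submodule.le_saturation _ (Submodule.subset_span ⟨m + 1, h1, rfl⟩)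
      · obtain rfl : m + 1 = r := le_antisymm hm h1
        exact h

theorem Derivation.exists_finiteOrder_of_relation {D : Derivation k A A} (hD : D.Preserves P)
    {f : A} (c : ℕ →₀ P) (hc : c ≠ 0) (h : c.sum (fun n p => p • D^[n] f) = 0) :
    ∃ r, D.FiniteOrder P f r := by
  classical
  have hne : c.support.Nonempty := Finsupp.support_nonempty_iff.2 hc
  set r := c.support.max' hne with hr
  have hrc : c r ≠ 0 := Finsupp.mem_support_iff.1 (c.support.max'_mem hne)
  have key : D^[r] f ∈ (Submodule.span P ((fun m => D^[m] f) '' Set.Iio r)).saturation := by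
    refine ⟨c r, hrc, ?_⟩
    rw [Finsupp.sum, ← Finset.add_sum_erase _ _ (c.support.max'_mem hne)] at h
    rw [eq_neg_of_add_eq_zero_left h]
    refine Submodule.neg_mem _ (Submodule.sum_mem _ fun n hn => Submodule.smul_mem _ _
      (Submodule.subset_span ⟨n, ?_, rfl⟩))
    exact lt_of_le_of_ne (c.support.le_max' _ (Finset.mem_of_mem_erase hn))
      (Finset.ne_of_mem_erase hn)
  refine ⟨r, D.finiteOrder_of_mem hD ?_ key⟩
  -- If `r = 0`, the relation itself says that a non-zero multiple of `f` vanishes.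
  rcases Nat.eq_zero_or_pos r with h0 | h0
  · rw [h0] at key ⊢
    exact key
  · exact Submodule.le_saturation _ (Submodule.subset_span ⟨0, h0, rfl⟩)

/-- Two commuting derivations for which `f` is D-finite: all mixed derivatives of `f` lie, up to
denominators, in a finitely generated module that is stable under both derivations, and under any
derivation that commutes with them and kills `f`. -/
theorem Derivation.exists_stable_of_finiteOrder {D E : Derivation k A A} (hD : D.Preserves P)
    (hE : E.Preserves P) (hDE : Function.Commute D E) {f : A} {r s : ℕ}
    (hr : D.FiniteOrder P f r) (hs : E.FiniteOrder P f s) :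
    ∃ N : Submodule P A, N.FG ∧ f ∈ N.saturation ∧ (∀ x ∈ N, D x ∈ N.saturation) ∧
      (∀ x ∈ N, E x ∈ N.saturation) ∧ ∀ H : Derivation k A A, H.Preserves P →
        Function.Commute H D → Function.Commute H E → H f = 0 →
        ∀ x ∈ N, H x ∈ N.saturation := by
  set N : Submodule P A := Submodule.span P
    ((fun p : ℕ × ℕ => E^[p.2] (D^[p.1] f)) '' (Set.Iio r ×ˢ Set.Iio s)) with hN
  have hcomm : ∀ a b, D^[a] (E^[b] f) = E^[b] (D^[a] f) :=
    fun a b => (hDE.iterate_iterate a b) f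
  have key : ∀ a b, D^[a] (E^[b] f) ∈ N.saturation := by
    intro a b
    -- First reduce the power of `E` below `s`, then differentiate by `D`. After commuting, reduce
    -- the power of `D` below `r`; differentiating that reduction by `E` does not raise the power of
    -- `E` again.
    refine Submodule.saturation_le (Submodule.span_le.2 ?_) (D.iterate_mem_saturation hD (hs b) a)
    rintro _ ⟨a', -, _, ⟨b', hb', rfl⟩, rfl⟩
    simp only [hcomm, SetLike.mem_coe]
    refine Submodule.saturation_le (Submodule.span_le.2 ?_)
      (E.iterate_mem_saturation hE (hr a') b')
    rintro _ ⟨b'', hb'', _, ⟨a'', ha'', rfl⟩, rfl⟩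
    exact Submodule.le_saturation _ (Submodule.subset_span
      ⟨(a'', b''), ⟨ha'', lt_of_le_of_lt hb'' hb'⟩, rfl⟩)
  have hsub : ((fun p : ℕ × ℕ => E^[p.2] (D^[p.1] f)) '' (Set.Iio r ×ˢ Set.Iio s)) ⊆
      (N.saturation : Set A) := Submodule.subset_span.trans (N.le_saturation)
  refine ⟨N, Submodule.fg_span (((Set.finite_Iio r).prod (Set.finite_Iio s)).image _), key 0 0,
    fun x hx => D.map_mem_of_span hD hsub ?_ hx, fun x hx => E.map_mem_of_span hE hsub ?_ hx,
    fun H hH hHD hHE hHf x hx => H.map_mem_of_span hH hsub ?_ hx⟩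
  · rintro _ ⟨⟨a, b⟩, -, rfl⟩
    simp only [← hcomm, ← Function.iterate_succ_apply' D]
    exact key _ _
  · rintro _ ⟨⟨a, b⟩, -, rfl⟩
    have h := key a (b + 1)
    rwa [hcomm, Function.iterate_succ_apply'] at h
  · rintro _ ⟨⟨a, b⟩, -, rfl⟩
    have h : H (E^[b] (D^[a] f)) = 0 := by
      rw [(hHE.iterate_right b) (D^[a] f), (hHD.iterate_right a) f, hHf, iterate_map_zero,
        iterate_map_zero]
    simp only [h, zero_mem]

/-- By the Leibniz rule; each of the two terms needs the denominator of only one factor. -/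
theorem Derivation.map_mul_mem_saturation {D : Derivation k A A} {N M : Submodule P A}
    (hN : ∀ x ∈ N, D x ∈ N.saturation) (hM : ∀ x ∈ M, D x ∈ M.saturation) :
    ∀ x ∈ N * M, D x ∈ (N * M).saturation := by
  intro x hx
  induction hx using Submodule.mul_induction_on' with
  | mem_mul_mem a ha b hb =>
    rw [D.leibniz, smul_eq_mul, smul_eq_mul]
    obtain ⟨p, hp, hpa⟩ := hN a ha
    obtain ⟨q, hq, hqb⟩ := hM b hb
    refine add_mem ⟨q, hq, ?_⟩ ⟨p, hp, ?_⟩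
    · rw [← mul_smul_comm]
      exact Submodule.mul_mem_mul ha hqb
    · rw [mul_comm b, ← smul_mul_assoc]
      exact Submodule.mul_mem_mul hpa hb
  | add x _ y _ hx hy => rw [map_add]; exact add_mem hx hy

theorem Submodule.mul_mem_saturation {N M : Submodule P A} {x y : A} (hx : x ∈ N.saturation)
    (hy : y ∈ M.saturation) : x * y ∈ (N * M).saturation := by
  obtain ⟨p, hp, hpx⟩ := hx
  obtain ⟨q, hq, hqy⟩ := hy
  refine ⟨p * q, mul_ne_zero hp hq, ?_⟩
  rw [← smul_mul_smul_comm]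
  exact Submodule.mul_mem_mul hpx hqy

end Saturation

/-! ### Counting differential operators -/

section Counting

variable {k P A : Type*} [CommRing k] [CommRing P] [CommRing A] [Algebra k P] [Algebra P A]

/-- An exhaustive multiplicative filtration of `P` by `C`-modules, of linear growth. -/
structure LinearFiltration (C : Subalgebra k P) where
  /-- The terms of the filtration. -/
  level : ℕ → Submodule C P
  mono : Monotone level
  mul_mem : ∀ {m n : ℕ} {p q : P}, p ∈ level m → q ∈ level n → p * q ∈ level (m + n)
  exhaustive : ∀ p : P, ∃ n, p ∈ level n
  growth : ∀ n, ∃ s : Finset P, s.card ≤ 2 * n + 1 ∧ level n = Submodule.span C s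

variable {C : Subalgebra k P}

/-- The combinations of the elements of `s` with coefficients in the `n`-th term. -/
def LinearFiltration.combinations (F : LinearFiltration C) (s : Finset A) (n : ℕ) : Set A :=
  {x | ∃ f : A → P, (∀ e ∈ s, f e ∈ F.level n) ∧ x = ∑ e ∈ s, f e • e}

namespace LinearFiltration

variable (F : LinearFiltration C) (s : Finset A)

theorem combinations_mono {m n : ℕ} (h : m ≤ n) : F.combinations s m ⊆ F.combinations s n := by
  rintro x ⟨f, hf, rfl⟩
  exact ⟨f, fun e he => F.mono h (hf e he), rfl⟩

variable {s}

theorem zero_mem_combinations (n : ℕ) : (0 : A) ∈ F.combinations s n :=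
  ⟨0, fun _ _ => (F.level n).zero_mem, by simp⟩

theorem add_mem_combinations {n : ℕ} {x y : A} (hx : x ∈ F.combinations s n)
    (hy : y ∈ F.combinations s n) : x + y ∈ F.combinations s n := by
  obtain ⟨f, hf, rfl⟩ := hx
  obtain ⟨g, hg, rfl⟩ := hy
  exact ⟨f + g, fun e he => (F.level n).add_mem (hf e he) (hg e he), by
    simp [add_smul, Finset.sum_add_distrib]⟩

theorem sum_mem_combinations {ι : Type*} {n : ℕ} (t : Finset ι) (x : ι → A)
    (hx : ∀ i ∈ t, x i ∈ F.combinations s n) : ∑ i ∈ t, x i ∈ F.combinations s n := by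
  classical
  induction t using Finset.induction_on with
  | empty => exact F.zero_mem_combinations n
  | insert a t ha ih =>
    rw [Finset.sum_insert ha]
    exact F.add_mem_combinations (hx a (Finset.mem_insert_self _ _))
      (ih fun i hi => hx i (Finset.mem_insert_of_mem hi))

theorem smul_mem_combinations {m n : ℕ} {p : P} {x : A} (hp : p ∈ F.level m)
    (hx : x ∈ F.combinations s n) : p • x ∈ F.combinations s (m + n) := by
  obtain ⟨f, hf, rfl⟩ := hx
  exact ⟨fun e => p * f e, fun e he => F.mul_mem hp (hf e he), by
    simp [Finset.smul_sum, mul_smul]⟩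

theorem neg_mem_combinations {n : ℕ} {x : A} (hx : x ∈ F.combinations s n) :
    -x ∈ F.combinations s n := by
  obtain ⟨f, hf, rfl⟩ := hx
  exact ⟨-f, fun e he => (F.level n).neg_mem (hf e he), by simp⟩

theorem nsmul_mem_combinations {n : ℕ} {x : A} (m : ℕ) (hx : x ∈ F.combinations s n) :
    m • x ∈ F.combinations s n := by
  obtain ⟨f, hf, rfl⟩ := hx
  exact ⟨m • f, fun e he => (F.level n).nsmul_mem (hf e he) m, by
    simp only [Pi.smul_apply, Finset.smul_sum, smul_assoc]⟩

theorem mem_combinations_of_mem {n : ℕ} {p : P} {e : A} (hp : p ∈ F.level n) (he : e ∈ s) :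
    p • e ∈ F.combinations s n := by
  classical
  refine ⟨fun x => if x = e then p else 0, fun x _ => ?_, ?_⟩
  · dsimp only
    split_ifs
    · exact hp
    · exact (F.level n).zero_mem
  · simp [ite_smul, he]

theorem exists_mem_combinations_of_mem_span {x : A} (hx : x ∈ Submodule.span P (s : Set A)) :
    ∃ n, x ∈ F.combinations s n := by
  induction hx using Submodule.span_induction with
  | mem x hx =>
    obtain ⟨n, hn⟩ := F.exhaustive 1
    exact ⟨n, by simpa using F.mem_combinations_of_mem hn hx⟩
  | zero => exact ⟨0, F.zero_mem_combinations 0⟩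
  | add x y _ _ hx hy =>
    obtain ⟨m, hm⟩ := hx
    obtain ⟨n, hn⟩ := hy
    exact ⟨max m n, F.add_mem_combinations (F.combinations_mono s (le_max_left _ _) hm)
      (F.combinations_mono s (le_max_right _ _) hn)⟩
  | smul p x _ hx =>
    obtain ⟨m, hm⟩ := F.exhaustive p
    obtain ⟨n, hn⟩ := hx
    exact ⟨m + n, F.smul_mem_combinations hm hn⟩

theorem exists_level_bound (t : Finset A) (ht : ∀ x ∈ t, ∃ n, x ∈ F.combinations s n) :
    ∃ n, ∀ x ∈ t, x ∈ F.combinations s n := by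
  choose! f hf using ht
  exact ⟨t.sup f, fun x hx => F.combinations_mono s (Finset.le_sup hx) (hf x hx)⟩

variable [Algebra k A]

/-- The derivation `D` raises the level of elements of `P` by at most one. -/
def IsDerivation (D : Derivation k A A) : Prop :=
  ∀ n, ∀ p ∈ F.level n, ∃ p' ∈ F.level (n + 1), D (algebraMap P A p) = algebraMap P A p'

/-- Effect of a derivation on elements with bounded denominators and numerators. -/
theorem derivative_mem_combinations {D : Derivation k A A} (hD : F.IsDerivation D) {q : P} {c : ℕ}
    (hq : q ∈ F.level c) (hs : ∀ e ∈ s, q • D e ∈ F.combinations s c) {m n : ℕ} {x : A}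
    (hx : q ^ m • x ∈ F.combinations s n) :
    q ^ (m + 1) • D x ∈ F.combinations s (n + (c + 1)) := by
  obtain ⟨q', hq', hDq⟩ := hD c q hq
  have h1 : q • D (q ^ m • x) ∈ F.combinations s (n + (c + 1)) := by
    obtain ⟨f, hf, hx⟩ := hx
    rw [hx, map_sum, Finset.smul_sum]
    refine F.sum_mem_combinations _ _ fun e he => ?_
    obtain ⟨p', hp', hDp⟩ := hD n (f e) (hf e he)
    rw [D.map_smul_of_eq hDp, smul_add, smul_smul, smul_comm q (f e)]
    refine F.add_mem_combinations ?_ ?_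
    · exact F.combinations_mono s (by omega) (F.mem_combinations_of_mem (F.mul_mem hq hp') he)
    · exact F.combinations_mono s (by omega) (F.smul_mem_combinations (hf e he) (hs e he))
  have h2 : q' • (m • (q ^ m • x)) ∈ F.combinations s (n + (c + 1)) :=
    F.combinations_mono s (by omega)
      (F.smul_mem_combinations hq' (F.nsmul_mem_combinations m hx))
  -- The quotient rule without division: one more factor `q` absorbs the derivative of `q ^ m`.
  have h3 : q ^ (m + 1) • D x = q • D (q ^ m • x) + -(q' • (m • (q ^ m • x))) := by
    have h4 : algebraMap P A q * D (algebraMap P A q ^ m) =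
        m • (algebraMap P A q' * algebraMap P A q ^ m) := by
      rw [D.leibniz_pow, hDq]
      rcases m with _ | m
      · simp
      · simp only [Nat.add_sub_cancel, smul_eq_mul, nsmul_eq_mul, pow_succ]
        ring
    simp only [Algebra.smul_def, map_pow, D.leibniz] at h4 ⊢
    linear_combination (-x) * h4
  rw [h3]
  exact F.add_mem_combinations h1 (F.neg_mem_combinations h2)

theorem iterate_mem_combinations {D : Derivation k A A} (hD : F.IsDerivation D) {q : P} {c : ℕ}
    (hq : q ∈ F.level c) (hs : ∀ e ∈ s, q • D e ∈ F.combinations s c) {m n : ℕ} {x : A}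
    (hx : q ^ m • x ∈ F.combinations s n) (a : ℕ) :
    q ^ (m + a) • D^[a] x ∈ F.combinations s (n + a * (c + 1)) := by
  induction a with
  | zero => simpa using hx
  | succ a ih =>
    rw [Function.iterate_succ_apply', ← add_assoc, Nat.succ_mul, ← add_assoc]
    exact F.derivative_mem_combinations hD hq hs ih

omit [Algebra k A] in
theorem combinations_subset_span (s : Finset A) (n : ℕ) :
    ∃ t : Finset A, t.card ≤ (2 * n + 1) * s.card ∧
      F.combinations s n ⊆ Submodule.span C (t : Set A) := by
  classical
  obtain ⟨u, hu, hlev⟩ := F.growth n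
  refine ⟨Finset.image₂ (fun (p : P) (e : A) => p • e) u s, ?_, ?_⟩
  · exact (Finset.card_image₂_le _ _ _).trans (Nat.mul_le_mul_right _ hu)
  rintro x ⟨f, hf, rfl⟩
  refine Submodule.sum_mem _ fun e he => ?_
  have h := Submodule.mem_map_of_mem (f := (LinearMap.toSpanSingleton P A e).restrictScalars C)
    (hlev ▸ hf e he)
  rw [Submodule.map_span] at h
  refine Submodule.span_mono ?_ h
  rintro _ ⟨p, hp, rfl⟩
  exact Finset.mem_image₂_of_mem hp he

/-- If `g` lies in a finitely generated module that is stable under `D` and `E` (up to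
denominators), then the derivatives `Eᵇ Dᵃ g` satisfy a linear relation over `C`: in bidegree less
than `M`, there are `M ^ 2` of them, and they lie in a module with `O(M)` generators. -/
theorem exists_relation [IsDomain P] [IsDomain A] [FaithfulSMul P A] {D E : Derivation k A A}
    (hD : F.IsDerivation D) (hE : F.IsDerivation E) {N : Submodule P A} (hN : N.FG)
    (hND : ∀ x ∈ N, D x ∈ N.saturation) (hNE : ∀ x ∈ N, E x ∈ N.saturation) {g : A}
    (hg : g ∈ N.saturation) :
    ∃ (M : ℕ) (κ : ℕ → ℕ → C), (∃ a < M, ∃ b < M, κ a b ≠ 0) ∧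
      ∑ b ∈ Finset.range M, ∑ a ∈ Finset.range M, κ a b • E^[b] (D^[a] g) = 0 := by
  classical
  obtain ⟨s, rfl⟩ := hN
  obtain ⟨q, hq0, hq⟩ := Submodule.exists_common_denominator
    (insert g (s.image D ∪ s.image E)) (N := Submodule.span P (s : Set A)) (by
      intro x hx
      simp only [Finset.mem_insert, Finset.mem_union, Finset.mem_image] at hx
      rcases hx with rfl | ⟨e, he, rfl⟩ | ⟨e, he, rfl⟩
      · exact hg
      · exact hND e (Submodule.subset_span he)
      · exact hNE e (Submodule.subset_span he))
  obtain ⟨c₁, hc₁⟩ := F.exhaustive q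
  obtain ⟨c₂, hc₂⟩ := F.exists_level_bound (s := s)
    ((insert g (s.image D ∪ s.image E)).image (q • ·)) (by
      intro x hx
      obtain ⟨y, hy, rfl⟩ := Finset.mem_image.1 hx
      exact F.exists_mem_combinations_of_mem_span (hq y hy))
  -- A single bound `c` for the level of the denominator `q` and of all numerators.
  set c := max c₁ c₂ with hc
  have hqc : q ∈ F.level c := F.mono (le_max_left _ _) hc₁
  have hmem : ∀ x ∈ insert g (s.image D ∪ s.image E), q • x ∈ F.combinations s c := fun x hx =>
    F.combinations_mono s (le_max_right _ _) (hc₂ _ (Finset.mem_image_of_mem _ hx))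
  have hsD : ∀ e ∈ s, q • D e ∈ F.combinations s c := fun e he => hmem _ (by
    simp only [Finset.mem_insert, Finset.mem_union, Finset.mem_image]
    exact Or.inr (Or.inl ⟨e, he, rfl⟩))
  have hsE : ∀ e ∈ s, q • E e ∈ F.combinations s c := fun e he => hmem _ (by
    simp only [Finset.mem_insert, Finset.mem_union, Finset.mem_image]
    exact Or.inr (Or.inr ⟨e, he, rfl⟩))
  have hgc : q ^ 1 • g ∈ F.combinations s c := by
    rw [pow_one]
    exact hmem g (Finset.mem_insert_self _ _)
  -- The exponent `0` is set apart because a filtration is not required to have `1` in level `0`.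
  have hpow : ∀ n, q ^ n ∈ F.level (n * c) ∨ n = 0 := by
    intro n
    induction n with
    | zero => exact Or.inr rfl
    | succ n ih =>
      left
      rcases ih with ih | rfl
      · rw [pow_succ, Nat.succ_mul]
        exact F.mul_mem ih hqc
      · simpa using hqc
  -- Level `2 * M * (c + 1)` gives at most `(4 * M * (c + 1) + 1) * s.card` generators. This is at
  -- most `M * (M - 1)`, hence less than the number `M * M` of derivatives.
  set M := (4 * (c + 1) + 1) * s.card + 1 with hM
  have hbound : ∀ a < M, ∀ b < M,
      q ^ (2 * M) • E^[b] (D^[a] g) ∈ F.combinations s (2 * M * (c + 1)) := by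
    intro a ha b hb
    -- Each derivative costs one power of `q` and raises the level by `c + 1`. The denominators `q ^
    -- (1 + a + b)` are then brought to the common value `q ^ (2 * M)`.
    have h1 := F.iterate_mem_combinations hE hqc hsE
      (F.iterate_mem_combinations hD hqc hsD hgc a) b
    rcases hpow (2 * M - (1 + a + b)) with h2 | h2
    · have h3 := F.smul_mem_combinations h2 h1
      rw [smul_smul, ← pow_add] at h3
      rw [show 2 * M - (1 + a + b) + (1 + a + b) = 2 * M by omega] at h3
      refine F.combinations_mono s ?_ h3
      obtain ⟨d, hd⟩ : ∃ d, 2 * M = d + (1 + a + b) := ⟨2 * M - (1 + a + b), by omega⟩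
      rw [hd, Nat.add_sub_cancel]
      nlinarith
    · rw [show 1 + a + b = 2 * M by omega] at h1
      refine F.combinations_mono s ?_ h1
      rw [show 2 * M = 1 + a + b by omega]
      nlinarith
  obtain ⟨t, ht, hsub⟩ := F.combinations_subset_span s (2 * M * (c + 1))
  have hdep : ¬ LinearIndependent C (fun p : Fin M × Fin M =>
      q ^ (2 * M) • E^[p.2] (D^[p.1] g)) := by
    intro hli
    have h := linearIndependent_le_span_aux' _ hli (t : Set A) (by
      rintro _ ⟨p, rfl⟩
      exact hsub (hbound _ p.1.2 _ p.2.2))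
    simp only [Fintype.card_prod, Fintype.card_fin, Finset.coe_sort_coe, Fintype.card_coe] at h
    have h' := h.trans ht
    have h1 : 1 ≤ M := by omega
    have h2 : (2 * (2 * M * (c + 1)) + 1) * s.card ≤ M * ((4 * (c + 1) + 1) * s.card) := by
      have : 2 * (2 * M * (c + 1)) + 1 ≤ M * (4 * (c + 1) + 1) := by nlinarith
      calc _ ≤ M * (4 * (c + 1) + 1) * s.card := Nat.mul_le_mul_right _ this
        _ = _ := by ring
    have h3 : M * ((4 * (c + 1) + 1) * s.card) < M * M :=
      Nat.mul_lt_mul_of_pos_left (by omega) h1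
    omega
  rw [Fintype.not_linearIndependent_iff] at hdep
  obtain ⟨κ, hκ, ⟨a, b⟩, hab⟩ := hdep
  refine ⟨M, fun a b => if h : a < M ∧ b < M then κ (⟨a, h.1⟩, ⟨b, h.2⟩) else 0,
    ⟨a, a.2, b, b.2, ?_⟩, ?_⟩
  · simpa using hab
  · have h0 : algebraMap P A q ≠ 0 := by
      rwa [Ne, FaithfulSMul.algebraMap_eq_zero_iff]
    refine (mul_eq_zero.1 ?_).resolve_left (pow_ne_zero (2 * M) h0)
    rw [← map_pow, ← Algebra.smul_def, Finset.smul_sum, ← hκ, Fintype.sum_prod_type_right,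
      Finset.sum_range]
    refine Finset.sum_congr rfl fun b _ => ?_
    rw [Finset.smul_sum, Finset.sum_range]
    refine Finset.sum_congr rfl fun a _ => ?_
    dsimp only
    rw [dif_pos ⟨a.2, b.2⟩, smul_comm]

end LinearFiltration

end Counting

/-! ### D-finite power series -/

instance {σ : Type} : IsDomain (MvPowerSeries σ ℚ) := NoZeroDivisors.to_isDomain _

theorem MvPowerSeries.algebraMap_mvPolynomial {σ : Type} (p : MvPolynomial σ ℚ) :
    algebraMap (MvPolynomial σ ℚ) (MvPowerSeries σ ℚ) p = (p : MvPowerSeries σ ℚ) := by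
  rw [MvPowerSeries.algebraMap_apply']
  ext m
  simp

instance {σ : Type} : FaithfulSMul (MvPolynomial σ ℚ) (MvPowerSeries σ ℚ) :=
  (faithfulSMul_iff_algebraMap_injective _ _).2 fun p q h => by
    simpa only [MvPowerSeries.algebraMap_mvPolynomial, MvPolynomial.coe_inj] using h

namespace MvPowerSeries

variable {σ τ : Type}

theorem preserves_pderiv (i : σ) : (pderiv ℚ i).Preserves (MvPolynomial σ ℚ) := fun p =>
  ⟨MvPolynomial.pderiv i p, by simp only [algebraMap_mvPolynomial, pderiv_coe]⟩

theorem commute_pderiv (i j : σ) :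
    Function.Commute (pderiv ℚ i : MvPowerSeries σ ℚ → _) (pderiv ℚ j) := by
  classical
  intro f
  ext m
  simp only [coeff_pderiv]
  rcases eq_or_ne i j with rfl | hij
  · rfl
  · rw [add_right_comm]
    simp only [Finsupp.add_apply, Finsupp.single_eq_of_ne hij, Finsupp.single_eq_of_ne hij.symm]
    push_cast
    ring

theorem pderiv_rename (e : σ ↪ τ) (i : σ) (F : MvPowerSeries σ ℚ) :
    pderiv ℚ (e i) (rename e F) = rename e (pderiv ℚ i F) := by
  ext m
  rw [coeff_pderiv]
  by_cases hm : m ∈ Set.range (Finsupp.mapDomain e : (σ →₀ ℕ) → (τ →₀ ℕ))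
  · obtain ⟨n, rfl⟩ := hm
    have h : Finsupp.mapDomain e n + Finsupp.single (e i) 1 =
        Finsupp.embDomain e (n + Finsupp.single i 1) := by
      rw [Finsupp.embDomain_eq_mapDomain, Finsupp.mapDomain_add, Finsupp.mapDomain_single]
    rw [h, coeff_embDomain_rename, ← Finsupp.embDomain_eq_mapDomain, coeff_embDomain_rename,
      coeff_pderiv, Finsupp.embDomain_apply_self]
  · rw [coeff_rename_eq_zero _ _ hm, coeff_rename_eq_zero, zero_mul]
    rintro ⟨n, hn⟩
    refine hm ⟨n - Finsupp.single i 1, ?_⟩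
    have hni : Finsupp.single i 1 ≤ n := by
      rw [Finsupp.single_le_iff]
      have h := DFunLike.congr_fun hn (e i)
      rw [Finsupp.mapDomain_apply e.injective] at h
      simp [h]
    rw [← tsub_add_cancel_of_le hni, Finsupp.mapDomain_add, Finsupp.mapDomain_single] at hn
    exact add_right_cancel hn

theorem pderiv_rename_of_notMem (e : σ ↪ τ) {j : τ} (hj : j ∉ Set.range e)
    (F : MvPowerSeries σ ℚ) : pderiv ℚ j (rename e F) = 0 := by
  ext m
  rw [coeff_pderiv, coeff_rename_eq_zero, zero_mul, map_zero]
  rintro ⟨n, hn⟩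
  have h := DFunLike.congr_fun hn j
  rw [Finsupp.mapDomain_of_notMem_range _ _ hj] at h
  simp at h

end MvPowerSeries

open MvPowerSeries

/-- A series is D-finite with respect to `i` if and only if it satisfies a non-trivial linear
differential equation with polynomial coefficients. -/
theorem isDFiniteIn_iff {σ : Type} {i : σ} {F : MvPowerSeries σ ℚ} : IsDFiniteIn i F ↔
    ∃ c : ℕ →₀ MvPolynomial σ ℚ, c ≠ 0 ∧ c.sum (fun n p => p • (pderiv ℚ i)^[n] F) = 0 := by
  set K := FractionRing (MvPolynomial σ ℚ)
  constructor
  · intro h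
    have hdep : ¬ LinearIndependent K (fun n : ℕ => toRatSpan σ ((pderiv ℚ i)^[n] F)) := by
      intro hli
      have : FiniteDimensional K (Submodule.span K
        (Set.range fun m : ℕ => toRatSpan σ ((pderiv ℚ i)^[m] F))) := h
      have h2 := (linearIndependent_span hli).finite
      exact not_finite ℕ
    -- Clearing denominators: a dependence over rational functions yields one with polynomial
    -- coefficients.
    rw [← LinearIndependent.iff_fractionRing (MvPolynomial σ ℚ),
      linearIndependent_iff] at hdep
    push Not at hdep
    obtain ⟨c, hc, hc0⟩ := hdep
    refine ⟨c, hc0, toRatSpan_injective σ ?_⟩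
    rw [Finsupp.linearCombination_apply] at hc
    simp only [toRatSpan] at hc ⊢
    simpa only [Finsupp.sum, map_sum, map_smul, map_zero] using hc
  · rintro ⟨c, hc0, hc⟩
    obtain ⟨r, hr⟩ := (pderiv ℚ i).exists_finiteOrder_of_relation (preserves_pderiv i) c hc0 hc
    set s : Set (MvPowerSeries σ ℚ) := (fun m => (pderiv ℚ i)^[m] F) '' Set.Iio r
    have hfin : (toRatSpan σ '' s).Finite := ((Set.finite_Iio r).image _).image _
    have hle : Submodule.span K (Set.range fun m : ℕ => toRatSpan σ ((pderiv ℚ i)^[m] F)) ≤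
        Submodule.span K (toRatSpan σ '' s) := by
      rw [Submodule.span_le]
      rintro _ ⟨m, rfl⟩
      obtain ⟨q, hq0, hq⟩ := hr m
      have h1 := Submodule.mem_map_of_mem (f := LocalizedModule.mkLinearMap
        (nonZeroDivisors (MvPolynomial σ ℚ)) (MvPowerSeries σ ℚ)) hq
      rw [Submodule.map_span, map_smul] at h1
      have h2 := Submodule.span_le_restrictScalars (MvPolynomial σ ℚ) K _ h1
      have hqK : algebraMap (MvPolynomial σ ℚ) K q ≠ 0 := by
        rwa [Ne, FaithfulSMul.algebraMap_eq_zero_iff]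
      rw [Submodule.restrictScalars_mem, algebra_compatible_smul K q] at h2
      exact (Submodule.smul_mem_iff _ hqK).1 h2
    have : FiniteDimensional K (Submodule.span K (toRatSpan σ '' s)) :=
      FiniteDimensional.span_of_finite K hfin
    exact Submodule.finiteDimensional_of_le hle

/-- For an old variable the differential equation is renamed; for a new one the derivative of the
series is zero, which is itself an equation. -/
theorem IsDFinite.exists_finiteOrder_rename {σ τ : Type} {F : MvPowerSeries σ ℚ}
    (hF : IsDFinite F) (e : σ ↪ τ) (j : τ) :
    ∃ r, (pderiv ℚ j).FiniteOrder (MvPolynomial τ ℚ) (rename e F) r := by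
  by_cases hj : j ∈ Set.range e
  · obtain ⟨i, rfl⟩ := hj
    obtain ⟨c, hc0, hc⟩ := isDFiniteIn_iff.1 (hF i)
    have hinj : Function.Injective (MvPolynomial.rename e : MvPolynomial σ ℚ →ₐ[ℚ] _) :=
      MvPolynomial.rename_injective _ e.injective
    refine (pderiv ℚ (e i)).exists_finiteOrder_of_relation (preserves_pderiv _)
      (c.mapRange (MvPolynomial.rename e) (map_zero _)) ?_ ?_
    · rwa [Ne, ← Finsupp.mapRange_zero (hf := map_zero (MvPolynomial.rename (R := ℚ) e)),
        (Finsupp.mapRange_injective _ (map_zero _) hinj).eq_iff]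
    · have hiter : ∀ n, (pderiv ℚ (e i))^[n] (rename e F) = rename e ((pderiv ℚ i)^[n] F) := by
        intro n
        induction n with
        | zero => rfl
        | succ n ih => rw [Function.iterate_succ_apply', ih, pderiv_rename,
            Function.iterate_succ_apply']
      rw [Finsupp.sum_mapRange_index (by simp)]
      have h := congrArg (rename e) hc
      simpa only [Finsupp.sum, map_sum, map_zero, hiter, Algebra.smul_def,
        algebraMap_mvPolynomial, map_mul, rename_coe] using h
  · refine (pderiv ℚ j).exists_finiteOrder_of_relation (preserves_pderiv _)
      (Finsupp.single 1 1) (by simp) ?_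
    rw [Finsupp.sum_single_index (by simp)]
    simp [pderiv_rename_of_notMem e hj]

/-! ### Diagonals -/

namespace Diagonal

variable {ζ : Type}

/-- Polynomials in the variables `ζ` and one more variable are mapped to polynomials with two more
variables, whose product is the image of the additional variable. -/
noncomputable def substProd (ζ : Type) :
    MvPolynomial (Option ζ) ℚ →ₐ[ℚ] MvPolynomial (Option (Option ζ)) ℚ :=
  MvPolynomial.aeval fun o => o.elim (MvPolynomial.X none * MvPolynomial.X (some none))
    fun z => MvPolynomial.X (some (some z))

@[simp]
theorem substProd_X_none : substProd ζ (MvPolynomial.X none) =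
    MvPolynomial.X none * MvPolynomial.X (some none) := by
  simp [substProd]

@[simp]
theorem substProd_X_some (z : ζ) : substProd ζ (MvPolynomial.X (some z)) =
    MvPolynomial.X (some (some z)) := by
  simp [substProd]

/-- The derivation `v w ∂_v - w² ∂_w`, where `w` is the variable `none` and `v` is `some none`. It
kills the product `v w`. -/
noncomputable def eulerPoly (ζ : Type) : Derivation ℚ (MvPolynomial (Option (Option ζ)) ℚ)
    (MvPolynomial (Option (Option ζ)) ℚ) :=
  (MvPolynomial.X none * MvPolynomial.X (some none) : MvPolynomial (Option (Option ζ)) ℚ) •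
    MvPolynomial.pderiv (some none) -
    (MvPolynomial.X none ^ 2 : MvPolynomial (Option (Option ζ)) ℚ) • MvPolynomial.pderiv none

/-- The derivation `v w ∂_v - w² ∂_w` on power series. -/
noncomputable def euler (ζ : Type) : Derivation ℚ (MvPowerSeries (Option (Option ζ)) ℚ)
    (MvPowerSeries (Option (Option ζ)) ℚ) :=
  (X none * X (some none) : MvPowerSeries (Option (Option ζ)) ℚ) • pderiv ℚ (some none) -
    (X none ^ 2 : MvPowerSeries (Option (Option ζ)) ℚ) • pderiv ℚ none

theorem euler_apply (F : MvPowerSeries (Option (Option ζ)) ℚ) :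
    euler ζ F = (MvPolynomial.X none * MvPolynomial.X (some none) :
      MvPolynomial (Option (Option ζ)) ℚ) • pderiv ℚ (some none) F -
      (MvPolynomial.X none ^ 2 : MvPolynomial (Option (Option ζ)) ℚ) • pderiv ℚ none F := by
  simp [euler, Algebra.smul_def, algebraMap_mvPolynomial]

theorem euler_coe (p : MvPolynomial (Option (Option ζ)) ℚ) :
    euler ζ (p : MvPowerSeries (Option (Option ζ)) ℚ) = (eulerPoly ζ p : MvPolynomial _ ℚ) := by
  rw [euler_apply, pderiv_coe, pderiv_coe]
  simp only [Algebra.smul_def, ← algebraMap_mvPolynomial, ← map_mul, ← map_sub]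
  rfl

theorem pderiv_substProd (z : ζ) (p : MvPolynomial (Option ζ) ℚ) :
    MvPolynomial.pderiv (some (some z)) (substProd ζ p) =
      substProd ζ (MvPolynomial.pderiv (some z) p) := by
  classical
  induction p using MvPolynomial.induction_on with
  | C a => simp [substProd]
  | add p q hp hq => simp [hp, hq]
  | mul_X p o hp =>
    rcases o with _ | y
    · simp [hp, MvPolynomial.pderiv_X, Derivation.leibniz]
    · simp only [map_mul, Derivation.leibniz, hp, substProd_X_some, MvPolynomial.pderiv_X,
        Pi.single_apply, Option.some_inj, smul_eq_mul, map_add]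
      split_ifs <;> simp

/-- The ring `C` consists of constants for `E`. This makes `E` linear over `C`, so that coefficients
of relations pass through its powers. -/
theorem eulerPoly_substProd (p : MvPolynomial (Option ζ) ℚ) :
    eulerPoly ζ (substProd ζ p) = 0 := by
  induction p using MvPolynomial.induction_on with
  | C a => simp [substProd]
  | add p q hp hq => simp [hp, hq]
  | mul_X p o hp =>
    rw [map_mul, Derivation.leibniz, hp]
    rcases o with _ | y
    · simp [eulerPoly, Derivation.leibniz, MvPolynomial.pderiv_X_of_ne]
      exact Or.inr (by ring)
    · simp [eulerPoly, MvPolynomial.pderiv_X_of_ne]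

/-- The powers of `v` and `w` up to degree `n`. -/
noncomputable def powers (ζ : Type) (n : ℕ) : Finset (MvPolynomial (Option (Option ζ)) ℚ) :=
  open Classical in
  (Finset.range (n + 1)).image (fun j => MvPolynomial.X none ^ j) ∪
    (Finset.range n).image (fun j => MvPolynomial.X (some none) ^ (j + 1))

/-- The polynomials that have degree at most `n` in `v` and `w` up to powers of `v w`. -/
noncomputable def level (ζ : Type) (n : ℕ) :
    Submodule (substProd ζ).range (MvPolynomial (Option (Option ζ)) ℚ) :=
  Submodule.span _ (powers ζ n : Set _)

theorem substProd_mul_mem {n : ℕ} (p : MvPolynomial (Option ζ) ℚ)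
    {q : MvPolynomial (Option (Option ζ)) ℚ} (hq : q ∈ level ζ n) :
    substProd ζ p * q ∈ level ζ n :=
  (level ζ n).smul_mem (⟨substProd ζ p, p, rfl⟩ : (substProd ζ).range) hq

theorem exists_of_mem_powers {n : ℕ} {p : MvPolynomial (Option (Option ζ)) ℚ}
    (hp : p ∈ powers ζ n) : ∃ a b, a + b ≤ n ∧
      p = MvPolynomial.X none ^ a * MvPolynomial.X (some none) ^ b := by
  classical
  simp only [powers, Finset.mem_union, Finset.mem_image, Finset.mem_range] at hp
  rcases hp with ⟨j, hj, rfl⟩ | ⟨j, hj, rfl⟩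
  · exact ⟨j, 0, by omega, by simp⟩
  · exact ⟨0, j + 1, by omega, by simp⟩

/-- The common power of `v w` is a scalar from `C`; what remains is a pure power of `v` or of `w`.
-/
theorem pow_mul_pow_mem {n a b : ℕ} (h : a + b ≤ n) :
    (MvPolynomial.X none ^ a * MvPolynomial.X (some none) ^ b :
      MvPolynomial (Option (Option ζ)) ℚ) ∈ level ζ n := by
  classical
  rcases le_total b a with hab | hab
  · obtain ⟨c, rfl⟩ := Nat.exists_eq_add_of_le hab
    have h1 : (MvPolynomial.X none ^ c : MvPolynomial (Option (Option ζ)) ℚ) ∈ level ζ n := by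
      refine Submodule.subset_span ?_
      simp only [powers, Finset.mem_coe, Finset.mem_union, Finset.mem_image, Finset.mem_range]
      exact Or.inl ⟨c, by omega, rfl⟩
    have h2 := substProd_mul_mem (MvPolynomial.X none ^ b) h1
    rw [map_pow, substProd_X_none] at h2
    convert h2 using 1
    ring
  · obtain ⟨c, rfl⟩ := Nat.exists_eq_add_of_le hab
    have h1 : (MvPolynomial.X (some none) ^ c : MvPolynomial (Option (Option ζ)) ℚ) ∈
        level ζ n := by
      refine Submodule.subset_span ?_
      simp only [powers, Finset.mem_coe, Finset.mem_union, Finset.mem_image, Finset.mem_range]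
      rcases c with _ | c
      · exact Or.inl ⟨0, by omega, by simp⟩
      · exact Or.inr ⟨c, by omega, rfl⟩
    have h2 := substProd_mul_mem (MvPolynomial.X none ^ a) h1
    rw [map_pow, substProd_X_none] at h2
    convert h2 using 1
    ring

theorem level_mono : Monotone (level ζ) := fun m n h => Submodule.span_le.2 fun p hp => by
  obtain ⟨a, b, hab, rfl⟩ := exists_of_mem_powers hp
  exact pow_mul_pow_mem (hab.trans h)

theorem level_mul_mem {m n : ℕ} {p q : MvPolynomial (Option (Option ζ)) ℚ} (hp : p ∈ level ζ m)
    (hq : q ∈ level ζ n) : p * q ∈ level ζ (m + n) := by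
  have h := Submodule.mul_mem_mul hp hq
  rw [level, level, Submodule.span_mul_span] at h
  refine Submodule.span_le.2 ?_ h
  rintro _ ⟨p, hp, q, hq, rfl⟩
  obtain ⟨a, b, hab, rfl⟩ := exists_of_mem_powers hp
  obtain ⟨c, d, hcd, rfl⟩ := exists_of_mem_powers hq
  have h := pow_mul_pow_mem (ζ := ζ) (n := m + n) (a := a + c) (b := b + d) (by omega)
  simp only [SetLike.mem_coe]
  convert h using 1
  ring

/-- The filtration by the degree in `v` and `w`. -/
noncomputable def filtration (ζ : Type) : LinearFiltration (substProd ζ).range where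
  level := level ζ
  mono := level_mono
  mul_mem := level_mul_mem
  exhaustive := by
    intro p
    induction p using MvPolynomial.induction_on with
    | C a =>
      have h := substProd_mul_mem (MvPolynomial.C a) (pow_mul_pow_mem (ζ := ζ) (le_refl (0 + 0)))
      exact ⟨0, by simpa [substProd] using h⟩
    | add p q hp hq =>
      obtain ⟨m, hm⟩ := hp
      obtain ⟨n, hn⟩ := hq
      exact ⟨max m n, add_mem (level_mono (le_max_left _ _) hm) (level_mono (le_max_right _ _) hn)⟩
    | mul_X p o hp =>
      obtain ⟨m, hm⟩ := hp
      rcases o with _ | _ | z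
      · exact ⟨m + 1, level_mul_mem hm (by simpa using pow_mul_pow_mem (le_refl (1 + 0)))⟩
      · exact ⟨m + 1, level_mul_mem hm (by simpa using pow_mul_pow_mem (le_refl (0 + 1)))⟩
      · refine ⟨m, ?_⟩
        rw [mul_comm, ← substProd_X_some]
        exact substProd_mul_mem _ hm
  growth := by
    classical
    intro n
    refine ⟨powers ζ n, ?_, rfl⟩
    refine (Finset.card_union_le _ _).trans ?_
    have h1 := Finset.card_image_le (s := Finset.range (n + 1))
      (f := fun j => (MvPolynomial.X none ^ j : MvPolynomial (Option (Option ζ)) ℚ))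
    have h2 := Finset.card_image_le (s := Finset.range n)
      (f := fun j => (MvPolynomial.X (some none) ^ (j + 1) : MvPolynomial (Option (Option ζ)) ℚ))
    rw [Finset.card_range] at h1 h2
    exact (Nat.add_le_add h1 h2).trans (by omega)

/-- A derivation of polynomials that maps the coefficients to coefficients and raises the degree of
powers of `v` and `w` by at most one raises the degree in `v` and `w` by at most one. -/
theorem derivation_mem_level (D : Derivation ℚ (MvPolynomial (Option (Option ζ)) ℚ)
      (MvPolynomial (Option (Option ζ)) ℚ))
    (hC : ∀ p, ∃ p', D (substProd ζ p) = substProd ζ p')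
    (hw : ∀ n j, j ≤ n → D (MvPolynomial.X none ^ j) ∈ level ζ (n + 1))
    (hv : ∀ n j, j ≤ n → D (MvPolynomial.X (some none) ^ j) ∈ level ζ (n + 1)) {n : ℕ}
    {p : MvPolynomial (Option (Option ζ)) ℚ} (hp : p ∈ level ζ n) : D p ∈ level ζ (n + 1) := by
  classical
  induction hp using Submodule.span_induction with
  | mem x hx =>
    simp only [powers, Finset.mem_coe, Finset.mem_union, Finset.mem_image, Finset.mem_range] at hx
    rcases hx with ⟨j, hj, rfl⟩ | ⟨j, hj, rfl⟩
    · exact hw n j (by omega)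
    · exact hv n (j + 1) (by omega)
  | zero => simp
  | add x y _ _ hx hy => rw [map_add]; exact add_mem hx hy
  | smul c x hxs hx =>
    obtain ⟨_, p, rfl⟩ := c
    obtain ⟨p', hp'⟩ := hC p
    change D (substProd ζ p * x) ∈ _
    rw [D.leibniz, hp', smul_eq_mul, smul_eq_mul, mul_comm x]
    exact add_mem (substProd_mul_mem _ hx)
      (substProd_mul_mem _ (level_mono (Nat.le_succ n) hxs))

theorem isDerivation_pderiv (z : ζ) :
    (filtration ζ).IsDerivation (pderiv ℚ (some (some z))) := by
  intro n p hp
  refine ⟨MvPolynomial.pderiv (some (some z)) p, ?_, ?_⟩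
  · refine derivation_mem_level _ (fun p => ⟨_, pderiv_substProd z p⟩) ?_ ?_ hp
    · intro n j _
      rw [Derivation.leibniz_pow, MvPolynomial.pderiv_X_of_ne (by simp)]
      simp
    · intro n j _
      rw [Derivation.leibniz_pow, MvPolynomial.pderiv_X_of_ne (by simp)]
      simp
  · rw [algebraMap_mvPolynomial, algebraMap_mvPolynomial, pderiv_coe]

/-- `E` kills `C`, `E w = -w²` and `E v = w v`, so degrees in `v` and `w` rise by at most one. -/
theorem isDerivation_euler : (filtration ζ).IsDerivation (euler ζ) := by
  intro n p hp
  refine ⟨eulerPoly ζ p, ?_, ?_⟩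
  · refine derivation_mem_level _ (fun p => ⟨0, by rw [eulerPoly_substProd, map_zero]⟩) ?_ ?_ hp
    · intro n j hj
      rcases j with _ | j
      · simp
      rw [Derivation.leibniz_pow]
      refine Submodule.smul_of_tower_mem _ _ ?_
      have h := pow_mul_pow_mem (ζ := ζ) (n := n + 1) (a := j + 2) (b := 0) (by omega)
      convert neg_mem h using 1
      simp [eulerPoly, MvPolynomial.pderiv_X_of_ne]
      ring
    · intro n j hj
      rcases j with _ | j
      · simp
      rw [Derivation.leibniz_pow]
      refine Submodule.smul_of_tower_mem _ _ ?_
      have h := pow_mul_pow_mem (ζ := ζ) (n := n + 1) (a := 1) (b := j + 1) (by omega)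
      convert h using 1
      simp [eulerPoly, MvPolynomial.pderiv_X_of_ne]
      ring
  · rw [algebraMap_mvPolynomial, algebraMap_mvPolynomial, euler_coe]

end Diagonal

theorem MvPowerSeries.coeff_X_mul_pderiv {σ : Type} (i : σ) (m : σ →₀ ℕ) (F : MvPowerSeries σ ℚ) :
    coeff m (X i * pderiv ℚ i F) = m i * coeff m F := by
  classical
  by_cases h : Finsupp.single i 1 ≤ m
  · obtain ⟨k, rfl⟩ := le_iff_exists_add.1 h
    rw [X, coeff_add_monomial_mul, coeff_pderiv, add_comm k]
    simp
    ring
  · rw [X, coeff_monomial_mul, if_neg h]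
    rw [Finsupp.single_le_iff] at h
    simp [show m i = 0 by omega]

/-! ### Residues, and D-finiteness of diagonals -/

namespace Diagonal

variable {ζ : Type}

/-- `E` is `w` times `v ∂_v - w ∂_w`, which is diagonal on monomials with eigenvalue the difference
of the exponents. -/
theorem coeff_euler (m : Option (Option ζ) →₀ ℕ) (F : MvPowerSeries (Option (Option ζ)) ℚ) :
    coeff (Finsupp.single none 1 + m) (euler ζ F) =
      ((m (some none) : ℚ) - m none) * coeff m F := by
  have h : euler ζ F = X none * (X (some none) * pderiv ℚ (some none) F - X none * pderiv ℚ none F)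
      := by
    simp only [euler, Derivation.coe_sub, Derivation.coe_smul, Pi.sub_apply, Pi.smul_apply,
      smul_eq_mul]
    ring
  rw [h, X, coeff_add_monomial_mul, one_mul, map_sub]
  change coeff m (X (some none) * _) - coeff m (X none * _) = _
  rw [coeff_X_mul_pderiv, coeff_X_mul_pderiv]
  ring

/-- Each application raises the exponent of `w` by one, so the eigenvalue is negative at the start
and only decreases: it never vanishes. -/
theorem coeff_euler_iterate_ne_zero {m : Option (Option ζ) →₀ ℕ} (hm : m (some none) < m none)
    {F : MvPowerSeries (Option (Option ζ)) ℚ} (hF : coeff m F ≠ 0) (n : ℕ) :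
    coeff (Finsupp.single none n + m) ((euler ζ)^[n] F) ≠ 0 := by
  induction n with
  | zero => simpa using hF
  | succ n ih =>
    rw [Function.iterate_succ_apply', add_comm n 1, Finsupp.single_add, add_assoc, coeff_euler]
    refine mul_ne_zero ?_ ih
    have h : (m (some none) : ℚ) < m none := by exact_mod_cast hm
    have hn : (0 : ℚ) ≤ n := n.cast_nonneg
    simp only [Finsupp.add_apply, Finsupp.single_eq_same,
      Finsupp.single_eq_of_ne (Option.some_ne_none _)]
    push_cast
    intro h0
    linarith

/-- The diagonal of a series with respect to the variables `none` and `some none`. -/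
noncomputable def diag (F : MvPowerSeries (Option (Option ζ)) ℚ) : MvPowerSeries (Option ζ) ℚ :=
  fun m => coeff (m.optionElim (m none)) F

/-- The part of a series formed by the monomials in which the exponent of the variable `none`
exceeds that of `some none` by one. -/
noncomputable def residue (ζ : Type) :
    MvPowerSeries (Option (Option ζ)) ℚ →ₗ[ℚ] MvPowerSeries (Option ζ) ℚ where
  toFun F := fun m => coeff (m.optionElim (m none + 1)) F
  map_add' F G := by
    ext m
    exact map_add (coeff (m.optionElim (m none + 1))) F G
  map_smul' r F := by
    ext m
    exact map_smul (coeff (m.optionElim (m none + 1))) r F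

theorem coeff_residue (m : Option ζ →₀ ℕ) (F : MvPowerSeries (Option (Option ζ)) ℚ) :
    coeff m (residue ζ F) = coeff (m.optionElim (m none + 1)) F := rfl

theorem coeff_diag (m : Option ζ →₀ ℕ) (F : MvPowerSeries (Option (Option ζ)) ℚ) :
    coeff m (diag F) = coeff (m.optionElim (m none)) F := rfl

theorem optionElim_add_one {σ : Type} (m : σ →₀ ℕ) (n : ℕ) :
    m.optionElim (n + 1) = Finsupp.single none 1 + m.optionElim n := by
  ext o
  rcases o with _ | o
  · simp [add_comm]
  · simp

theorem residue_X_mul (F : MvPowerSeries (Option (Option ζ)) ℚ) :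
    residue ζ (X none * F) = diag F := by
  ext m
  rw [coeff_residue, coeff_diag, optionElim_add_one, X, coeff_add_monomial_mul, one_mul]

/-- A monomial seen by the residue is `w` times one with equal exponents of `v` and `w`, where the
eigenvalue is zero. -/
theorem residue_euler (F : MvPowerSeries (Option (Option ζ)) ℚ) :
    residue ζ (euler ζ F) = 0 := by
  ext m
  rw [coeff_residue, optionElim_add_one, coeff_euler]
  simp

theorem residue_eq_zero_of_iterate {F : MvPowerSeries (Option (Option ζ)) ℚ} {n : ℕ}
    (h : (euler ζ)^[n] F = 0) : residue ζ F = 0 := by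
  ext m
  rw [coeff_residue]
  by_contra h0
  exact coeff_euler_iterate_ne_zero (by simp) h0 n (by rw [h, map_zero])

theorem residue_pderiv (z : ζ) (F : MvPowerSeries (Option (Option ζ)) ℚ) :
    residue ζ (pderiv ℚ (some (some z)) F) = pderiv ℚ (some z) (residue ζ F) := by
  ext m
  rw [coeff_residue, coeff_pderiv, coeff_pderiv, coeff_residue]
  have h : m.optionElim (m none + 1) + Finsupp.single (some (some z)) 1 =
      (m + Finsupp.single (some z) 1).optionElim
        ((m + Finsupp.single (some z) 1 : Option ζ →₀ ℕ) none + 1)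
      := by
    classical
    ext o
    rcases o with _ | o
    · simp
    · simp [Finsupp.single_apply]
  rw [h, Finsupp.optionElim_apply_some]

/-- Multiplication by `v w` or by another variable preserves the excess of the exponent of `w` over
that of `v`. -/
theorem residue_smul (p : MvPolynomial (Option ζ) ℚ) (F : MvPowerSeries (Option (Option ζ)) ℚ) :
    residue ζ (substProd ζ p • F) = p • residue ζ F := by
  classical
  induction p using MvPolynomial.induction_on generalizing F with
  | C a =>
    have h : substProd ζ (MvPolynomial.C a) = MvPolynomial.C a := by simp [substProd]
    rw [h]
    simp only [Algebra.smul_def, algebraMap_mvPolynomial, MvPolynomial.coe_C]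
    rw [← smul_eq_C_mul, ← smul_eq_C_mul, map_smul]
  | add p q hp hq => simp only [map_add, add_smul, hp, hq]
  | mul_X p o hp =>
    rw [map_mul, mul_smul, hp, mul_smul]
    congr 1
    simp only [Algebra.smul_def, algebraMap_mvPolynomial]
    rcases o with _ | z
    · rw [substProd_X_none, MvPolynomial.coe_mul, MvPolynomial.coe_X, MvPolynomial.coe_X,
        MvPolynomial.coe_X, mul_assoc, residue_X_mul]
      ext m
      rw [coeff_diag, X, X, coeff_monomial_mul, coeff_monomial_mul]
      simp only [Finsupp.single_le_iff, Finsupp.optionElim_apply_some, one_mul]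
      split_ifs with h
      · rw [coeff_residue]
        congr 2
        ext o
        rcases o with _ | o
        · simp
          omega
        · simp [Finsupp.single_apply]
      · rfl
    · rw [substProd_X_some, MvPolynomial.coe_X, MvPolynomial.coe_X]
      ext m
      rw [coeff_residue, X, X, coeff_monomial_mul, coeff_monomial_mul]
      simp only [Finsupp.single_le_iff, Finsupp.optionElim_apply_some, one_mul]
      split_ifs with h
      · rw [coeff_residue]
        congr 2
        ext o
        rcases o with _ | o
        · simp
        · simp [Finsupp.single_apply]
      · rfl

theorem euler_substProd_smul (p : MvPolynomial (Option ζ) ℚ)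
    (F : MvPowerSeries (Option (Option ζ)) ℚ) :
    euler ζ (substProd ζ p • F) = substProd ζ p • euler ζ F := by
  rw [Derivation.map_smul_of_eq (p' := 0), zero_smul, zero_add]
  rw [algebraMap_mvPolynomial, euler_coe, eulerPoly_substProd, map_zero, MvPolynomial.coe_zero]

theorem euler_iterate_substProd_smul (p : MvPolynomial (Option ζ) ℚ)
    (F : MvPowerSeries (Option (Option ζ)) ℚ) (n : ℕ) :
    (euler ζ)^[n] (substProd ζ p • F) = substProd ζ p • (euler ζ)^[n] F := by
  induction n with
  | zero => rfl
  | succ n ih => rw [Function.iterate_succ_apply', ih, euler_substProd_smul,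
      Function.iterate_succ_apply']

/-- If `∑ Eⁿ yₙ = 0` for the derivation `E = euler`, then the first non-zero `yₙ` has residue
zero. -/
theorem residue_eq_zero_of_sum {M j : ℕ} (hj : j < M)
    (y : ℕ → MvPowerSeries (Option (Option ζ)) ℚ) (hy : ∀ i < j, y i = 0)
    (h : ∑ b ∈ Finset.range M, (euler ζ)^[b] (y b) = 0) : residue ζ (y j) = 0 := by
  obtain ⟨n, rfl⟩ : ∃ n, M = j + (n + 1) := ⟨M - j - 1, by omega⟩
  have hsum : ∀ (m : ℕ) (s : Finset ℕ) (x : ℕ → MvPowerSeries (Option (Option ζ)) ℚ),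
      (euler ζ)^[m] (∑ b ∈ s, x b) = ∑ b ∈ s, (euler ζ)^[m] (x b) := by
    intro m s x
    induction m with
    | zero => rfl
    | succ m ih => simp only [Function.iterate_succ_apply', ih, map_sum]
  -- The sum becomes `Eʲ (y j + E (…))`. The series in brackets has residue zero by
  -- `residue_eq_zero_of_iterate`, and its second part has residue zero by `residue_euler`.
  rw [Finset.sum_range_add, Finset.sum_eq_zero (s := Finset.range j), zero_add] at h
  · simp only [Function.iterate_add_apply] at h
    rw [← hsum] at h
    have h1 := residue_eq_zero_of_iterate h
    rw [Finset.sum_range_succ', map_add, map_sum] at h1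
    simpa only [Function.iterate_succ_apply', residue_euler, Finset.sum_const_zero, zero_add,
      add_zero, Function.iterate_zero, id] using h1
  · intro i hi
    rw [hy i (Finset.mem_range.1 hi), iterate_map_zero]

/-- The series `F` and `G` are D-finite, `F` does not depend on the variable `none`, and `G` does
not depend on `some none`. Then the diagonal of `F * G` is D-finite with respect to the variables
other than the diagonal one. -/
theorem isDFiniteIn_diag_mul (z : ζ) {F G : MvPowerSeries (Option (Option ζ)) ℚ}
    (hF : ∀ i, ∃ r, (pderiv ℚ i).FiniteOrder (MvPolynomial (Option (Option ζ)) ℚ) F r)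
    (hG : ∀ i, ∃ r, (pderiv ℚ i).FiniteOrder (MvPolynomial (Option (Option ζ)) ℚ) G r)
    (hF0 : pderiv ℚ none F = 0) (hG0 : pderiv ℚ (some none) G = 0) :
    IsDFiniteIn (some z) (diag (F * G)) := by
  classical
  set P := MvPolynomial (Option (Option ζ)) ℚ
  set D := pderiv ℚ (some (some z) : Option (Option ζ))
  obtain ⟨r₁, hr₁⟩ := hF (some (some z))
  obtain ⟨r₂, hr₂⟩ := hF (some none)
  obtain ⟨r₃, hr₃⟩ := hG (some (some z))
  obtain ⟨r₄, hr₄⟩ := hG none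
  obtain ⟨N, hN, hFN, hND, hNv, hNw⟩ := Derivation.exists_stable_of_finiteOrder
    (preserves_pderiv _) (preserves_pderiv _) (commute_pderiv _ _) hr₁ hr₂
  obtain ⟨N', hN', hGN', hND', hNw', hNv'⟩ := Derivation.exists_stable_of_finiteOrder
    (preserves_pderiv _) (preserves_pderiv _) (commute_pderiv _ _) hr₃ hr₄
  replace hNw := hNw _ (preserves_pderiv none) (commute_pderiv _ _) (commute_pderiv _ _) hF0
  replace hNv' := hNv' _ (preserves_pderiv (some none)) (commute_pderiv _ _)
    (commute_pderiv _ _) hG0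
  have hE : ∀ L : Submodule P (MvPowerSeries (Option (Option ζ)) ℚ),
      (∀ x ∈ L, pderiv ℚ none x ∈ L.saturation) →
      (∀ x ∈ L, pderiv ℚ (some none) x ∈ L.saturation) → ∀ x ∈ L, euler ζ x ∈ L.saturation := by
    intro L h1 h2 x hx
    rw [euler_apply]
    exact sub_mem (Submodule.smul_mem _ _ (h2 x hx)) (Submodule.smul_mem _ _ (h1 x hx))
  -- The extra factor `w` makes the residue of this series the diagonal of `F * G`.
  have hg : X none * (F * G) ∈ (N * N').saturation := by
    have h := (N * N').saturation.smul_mem (MvPolynomial.X none)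
      (Submodule.mul_mem_saturation hFN hGN')
    rwa [Algebra.smul_def, algebraMap_mvPolynomial, MvPolynomial.coe_X] at h
  obtain ⟨M, κ, ⟨a₀, ha₀, b₀, hb₀, hκ₀⟩, hκ⟩ := (filtration ζ).exists_relation
    (isDerivation_pderiv z) isDerivation_euler (hN.mul hN')
    (Derivation.map_mul_mem_saturation hND hND')
    (Derivation.map_mul_mem_saturation (hE N hNw hNv) (hE N' hNw' hNv')) hg
  choose p hp using fun a b => (κ a b).2
  -- The lowest power of `E` that occurs with a non-zero coefficient is the one that survives.
  have hex : ∃ b, ∃ a < M, κ a b ≠ 0 := ⟨b₀, a₀, ha₀, hκ₀⟩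
  obtain ⟨a₁, ha₁, hκ₁⟩ := Nat.find_spec hex
  set j := Nat.find hex
  have hjM : j < M := (Nat.find_min' hex ⟨a₀, ha₀, hκ₀⟩).trans_lt hb₀
  have hsmul : ∀ a b (x : MvPowerSeries (Option (Option ζ)) ℚ),
      κ a b • x = substProd ζ (p a b) • x := fun a b x => by
    rw [Subalgebra.smul_def, ← hp]
    rfl
  have hres := residue_eq_zero_of_sum hjM
    (fun b => ∑ a ∈ Finset.range M, κ a b • D^[a] (X none * (F * G))) (by
      intro i hi
      refine Finset.sum_eq_zero fun a ha => ?_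
      have h := Nat.find_min hex hi
      push Not at h
      rw [h a (Finset.mem_range.1 ha), zero_smul]) (by
    rw [← hκ]
    refine Finset.sum_congr rfl fun b _ => ?_
    induction Finset.range M using Finset.induction_on with
    | empty => simp [iterate_map_zero]
    | insert a s ha ih =>
      rw [Finset.sum_insert ha, Finset.sum_insert ha, iterate_map_add, ih, hsmul, hsmul,
        euler_iterate_substProd_smul])
  have hiter : ∀ n x, residue ζ (D^[n] x) = (pderiv ℚ (some z))^[n] (residue ζ x) := by
    intro n x
    induction n with
    | zero => rfl
    | succ n ih => rw [Function.iterate_succ_apply', residue_pderiv, ih,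
        Function.iterate_succ_apply']
  simp only [map_sum, hsmul, residue_smul, hiter, residue_X_mul] at hres
  refine isDFiniteIn_iff.2 ⟨Finsupp.onFinset (Finset.range M)
    (fun a => if a < M then p a j else 0) (fun a ha => ?_), ?_, ?_⟩
  · rw [Finset.mem_range]
    by_contra h
    exact ha (if_neg h)
  · intro h
    have h1 := DFunLike.congr_fun h a₁
    rw [Finsupp.onFinset_apply, if_pos ha₁, Finsupp.zero_apply] at h1
    refine hκ₁ (Subtype.ext ?_)
    rw [← hp, h1]
    exact map_zero (substProd ζ)
  · rw [Finsupp.onFinset_sum _ (by simp), ← hres]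
    refine Finset.sum_congr rfl fun a ha => ?_
    rw [if_pos (Finset.mem_range.1 ha)]

end Diagonal

/-! ### Specialisation at one -/

namespace Diagonal

variable {ζ : Type}

/-- The substitution of one for the additional variable, in polynomials. -/
noncomputable def evalOne (ζ : Type) : MvPolynomial (Option ζ) ℚ →ₐ[ℚ] MvPolynomial ζ ℚ :=
  MvPolynomial.aeval fun o => o.elim 1 MvPolynomial.X

/-- Modulo `v - 1`, a polynomial equals its value at `v = 1`. -/
theorem X_sub_one_dvd_sub (p : MvPolynomial (Option ζ) ℚ) :
    (MvPolynomial.X none - 1) ∣ p - MvPolynomial.rename some (evalOne ζ p) := by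
  induction p using MvPolynomial.induction_on with
  | C a => simp [evalOne]
  | add p q hp hq =>
    rw [map_add, map_add, add_sub_add_comm]
    exact dvd_add hp hq
  | mul_X p o hp =>
    rw [map_mul, map_mul, show ∀ a b c d : MvPolynomial (Option ζ) ℚ,
      a * b - c * d = (a - c) * b + c * (b - d) by intros; ring]
    refine dvd_add (hp.mul_right _) (Dvd.dvd.mul_left ?_ _)
    rcases o with _ | z <;> simp [evalOne]

theorem X_sub_one_dvd {p : MvPolynomial (Option ζ) ℚ} (hp : evalOne ζ p = 0) :
    (MvPolynomial.X none - 1) ∣ p := by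
  simpa [hp] using X_sub_one_dvd_sub p

/-- The specialisation at one of the variable `none`. -/
noncomputable abbrev atOne (F : MvPowerSeries (Option ζ) ℚ) : MvPowerSeries ζ ℚ :=
  specialiseAtOne (optionEquivLeft ζ ℚ F)

/-- The specialisation at one of the variable `none` is well defined. -/
abbrev HasAtOne (F : MvPowerSeries (Option ζ) ℚ) : Prop :=
  CanSpecialiseAtOne (optionEquivLeft ζ ℚ F)

theorem coeff_atOne (F : MvPowerSeries (Option ζ) ℚ) (m : ζ →₀ ℕ) :
    coeff m (atOne F) = ∑ᶠ k : ℕ, coeff (m.optionElim k) F :=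
  finsum_congr fun k => coeff_coeff_optionEquivLeft F k m

theorem hasAtOne_iff {F : MvPowerSeries (Option ζ) ℚ} :
    HasAtOne F ↔ ∀ m : ζ →₀ ℕ, (Function.support fun k => coeff (m.optionElim k) F).Finite := by
  simp only [HasAtOne, CanSpecialiseAtOne, coeff_coeff_optionEquivLeft]
  rfl

theorem HasAtOne.zero : HasAtOne (0 : MvPowerSeries (Option ζ) ℚ) :=
  hasAtOne_iff.2 fun m => by simp

theorem atOne_zero : atOne (0 : MvPowerSeries (Option ζ) ℚ) = 0 := by
  ext m
  simp [coeff_atOne]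

theorem HasAtOne.add {F G : MvPowerSeries (Option ζ) ℚ} (hF : HasAtOne F) (hG : HasAtOne G) :
    HasAtOne (F + G) := hasAtOne_iff.2 fun m => by
  simp only [map_add]
  exact ((hasAtOne_iff.1 hF m).union (hasAtOne_iff.1 hG m)).subset (Function.support_add _ _)

theorem atOne_add {F G : MvPowerSeries (Option ζ) ℚ} (hF : HasAtOne F) (hG : HasAtOne G) :
    atOne (F + G) = atOne F + atOne G := by
  ext m
  simp only [map_add, coeff_atOne]
  exact finsum_add_distrib (hasAtOne_iff.1 hF m) (hasAtOne_iff.1 hG m)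

theorem HasAtOne.C_mul {F : MvPowerSeries (Option ζ) ℚ} (hF : HasAtOne F) (a : ℚ) :
    HasAtOne (C a * F) := hasAtOne_iff.2 fun m => by
  simp only [coeff_C_mul]
  exact (hasAtOne_iff.1 hF m).subset (Function.support_mul_subset_right _ _)

theorem atOne_C_mul {F : MvPowerSeries (Option ζ) ℚ} (hF : HasAtOne F) (a : ℚ) :
    atOne (C a * F) = C a * atOne F := by
  ext m
  simp only [coeff_atOne, coeff_C_mul]
  exact (mul_finsum' _ a (hasAtOne_iff.1 hF m)).symm

theorem coeff_X_none_mul_zero (F : MvPowerSeries (Option ζ) ℚ) (m : ζ →₀ ℕ) :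
    coeff (m.optionElim 0) (X none * F) = 0 := by
  classical
  rw [X, coeff_monomial_mul, if_neg]
  simp [Finsupp.single_le_iff]

theorem coeff_X_none_mul_succ (F : MvPowerSeries (Option ζ) ℚ) (m : ζ →₀ ℕ) (k : ℕ) :
    coeff (m.optionElim (k + 1)) (X none * F) = coeff (m.optionElim k) F := by
  rw [optionElim_add_one, X, coeff_add_monomial_mul, one_mul]

theorem HasAtOne.X_none_mul {F : MvPowerSeries (Option ζ) ℚ} (hF : HasAtOne F) :
    HasAtOne (X none * F) := hasAtOne_iff.2 fun m => by
  refine ((hasAtOne_iff.1 hF m).image Nat.succ).subset fun k hk => ?_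
  rcases k with _ | k
  · exact absurd (coeff_X_none_mul_zero F m) hk
  · refine ⟨k, ?_, rfl⟩
    rwa [Function.mem_support, coeff_X_none_mul_succ] at hk

theorem atOne_X_none_mul {F : MvPowerSeries (Option ζ) ℚ} (hF : HasAtOne F) :
    atOne (X none * F) = atOne F := by
  ext m
  rw [coeff_atOne, coeff_atOne]
  obtain ⟨N, hN⟩ := (hasAtOne_iff.1 hF m).bddAbove
  -- Multiplication by the variable shifts the support up by one, hence one more term on the left.
  rw [finsum_eq_sum_of_support_subset (s := Finset.range (N + 2)),
    finsum_eq_sum_of_support_subset (s := Finset.range (N + 1)), Finset.sum_range_succ',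
    coeff_X_none_mul_zero, add_zero]
  · exact Finset.sum_congr rfl fun k _ => coeff_X_none_mul_succ F m k
  · intro k hk
    have := hN hk
    simp only [Finset.coe_range, Set.mem_Iio]
    omega
  · intro k hk
    rcases k with _ | k
    · exact absurd (coeff_X_none_mul_zero F m) hk
    · rw [Function.mem_support, coeff_X_none_mul_succ] at hk
      have := hN hk
      simp only [Finset.coe_range, Set.mem_Iio]
      omega

theorem coeff_X_some_mul (F : MvPowerSeries (Option ζ) ℚ) (z : ζ) (m : ζ →₀ ℕ) (k : ℕ) :
    coeff (m.optionElim k) (X (some z) * F) =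
      if 1 ≤ m z then coeff ((m - Finsupp.single z 1).optionElim k) F else 0 := by
  classical
  rw [X, coeff_monomial_mul]
  simp only [Finsupp.single_le_iff, Finsupp.optionElim_apply_some, one_mul]
  congr 3
  ext o
  rcases o with _ | o
  · simp
  · simp [Finsupp.single_apply]

theorem HasAtOne.X_some_mul {F : MvPowerSeries (Option ζ) ℚ} (hF : HasAtOne F) (z : ζ) :
    HasAtOne (X (some z) * F) := hasAtOne_iff.2 fun m => by
  simp only [coeff_X_some_mul]
  split_ifs
  · exact hasAtOne_iff.1 hF _
  · simp

theorem atOne_X_some_mul (F : MvPowerSeries (Option ζ) ℚ) (z : ζ) :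
    atOne (X (some z) * F) = X z * atOne F := by
  classical
  ext m
  rw [coeff_atOne, X_def z, coeff_monomial_mul]
  simp only [Finsupp.single_le_iff, coeff_X_some_mul, one_mul]
  split_ifs
  · rw [coeff_atOne]
  · simp

theorem atOne_smul (p : MvPolynomial (Option ζ) ℚ) {F : MvPowerSeries (Option ζ) ℚ}
    (hF : HasAtOne F) : HasAtOne (p • F) ∧ atOne (p • F) = evalOne ζ p • atOne F := by
  induction p using MvPolynomial.induction_on generalizing F with
  | C a =>
    have h : evalOne ζ (MvPolynomial.C a) = MvPolynomial.C a := by simp [evalOne]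
    simp only [h, Algebra.smul_def, algebraMap_mvPolynomial, MvPolynomial.coe_C]
    exact ⟨hF.C_mul a, atOne_C_mul hF a⟩
  | add p q hp hq =>
    simp only [map_add, add_smul]
    exact ⟨(hp hF).1.add (hq hF).1, by rw [atOne_add (hp hF).1 (hq hF).1, (hp hF).2, (hq hF).2]⟩
  | mul_X p o hp =>
    have h : HasAtOne ((MvPolynomial.X o : MvPolynomial (Option ζ) ℚ) • F) ∧
        atOne ((MvPolynomial.X o : MvPolynomial (Option ζ) ℚ) • F) =
          evalOne ζ (MvPolynomial.X o) • atOne F := by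
      simp only [Algebra.smul_def, algebraMap_mvPolynomial, MvPolynomial.coe_X]
      rcases o with _ | z
      · refine ⟨hF.X_none_mul, ?_⟩
        simp [evalOne, atOne_X_none_mul hF]
      · refine ⟨hF.X_some_mul z, ?_⟩
        simp [evalOne, atOne_X_some_mul]
    rw [mul_smul, map_mul, mul_smul, ← h.2]
    exact hp h.1

theorem coeff_optionElim_pderiv (F : MvPowerSeries (Option ζ) ℚ) (z : ζ) (m : ζ →₀ ℕ) (k : ℕ) :
    coeff (m.optionElim k) (pderiv ℚ (some z) F) =
      coeff ((m + Finsupp.single z 1).optionElim k) F * (m z + 1) := by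
  rw [coeff_pderiv, Finsupp.optionElim_apply_some]
  congr 3
  classical
  ext o
  rcases o with _ | o
  · simp
  · simp [Finsupp.single_apply]

theorem HasAtOne.pderiv {F : MvPowerSeries (Option ζ) ℚ} (hF : HasAtOne F) (z : ζ) :
    HasAtOne (pderiv ℚ (some z) F) := hasAtOne_iff.2 fun m => by
  simp only [coeff_optionElim_pderiv]
  exact (hasAtOne_iff.1 hF _).subset (Function.support_mul_subset_left _ _)

theorem atOne_pderiv {F : MvPowerSeries (Option ζ) ℚ} (hF : HasAtOne F) (z : ζ) :
    atOne (MvPowerSeries.pderiv ℚ (some z) F) = MvPowerSeries.pderiv ℚ z (atOne F) := by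
  ext m
  rw [coeff_atOne, coeff_pderiv, coeff_atOne]
  simp only [coeff_optionElim_pderiv]
  exact (finsum_mul' _ _ (hasAtOne_iff.1 hF _)).symm

theorem atOne_pderiv_iterate {F : MvPowerSeries (Option ζ) ℚ} (hF : HasAtOne F) (z : ζ) (n : ℕ) :
    HasAtOne ((MvPowerSeries.pderiv ℚ (some z))^[n] F) ∧
      atOne ((MvPowerSeries.pderiv ℚ (some z))^[n] F) =
        (MvPowerSeries.pderiv ℚ z)^[n] (atOne F) := by
  induction n with
  | zero => exact ⟨hF, rfl⟩
  | succ n ih =>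
    simp only [Function.iterate_succ_apply']
    exact ⟨ih.1.pderiv z, by rw [atOne_pderiv ih.1, ih.2]⟩

/-- The specialisation at one of a D-finite series is D-finite: a differential equation that
vanishes at one can be divided by a power of `X none - 1`. -/
theorem isDFiniteIn_atOne {F : MvPowerSeries (Option ζ) ℚ} (hF : HasAtOne F) {z : ζ}
    (h : IsDFiniteIn (some z) F) : IsDFiniteIn z (atOne F) := by
  obtain ⟨c, hc0, hc⟩ := isDFiniteIn_iff.1 h
  obtain ⟨a, ha⟩ := Finsupp.ne_iff.1 hc0
  rw [Finsupp.zero_apply] at ha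
  -- The induction follows one fixed non-zero coefficient `c a`, which becomes a proper divisor of
  -- itself at each division by `v - 1`.
  have hwf : WellFounded (DvdNotUnit (α := MvPolynomial (Option ζ) ℚ)) := IsWellFounded.wf
  generalize hp : c a = p at ha
  induction p using hwf.induction generalizing c with
  | _ p ih =>
  by_cases hall : ∀ n, evalOne ζ (c n) = 0
  · have hX : (MvPolynomial.X none - 1 : MvPolynomial (Option ζ) ℚ) ≠ 0 ∧
        ¬ IsUnit (MvPolynomial.X none - 1 : MvPolynomial (Option ζ) ℚ) := by
      constructor
      · intro h0
        have := congrArg (MvPolynomial.aeval (fun _ : Option ζ => (0 : ℚ))) h0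
        simp at this
      · intro hu
        have := hu.map (evalOne ζ)
        simp [evalOne] at this
    choose f hf using fun n => X_sub_one_dvd (hall n)
    have hf0 : ∀ n, f n ≠ 0 → n ∈ c.support := fun n hn => by
      rw [Finsupp.mem_support_iff, hf n]
      exact mul_ne_zero hX.1 hn
    have hfa : f a ≠ 0 := by
      intro h0
      rw [hf a, h0, mul_zero] at hp
      exact ha hp.symm
    refine ih (f a) ⟨hfa, _, hX.2, by rw [← hp, hf a, mul_comm]⟩
      (Finsupp.onFinset c.support f hf0) ?_ ?_ rfl hfa
    · intro h0
      exact hfa (DFunLike.congr_fun h0 a)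
    · rw [Finsupp.onFinset_sum _ (by simp)]
      have hX' : algebraMap _ (MvPowerSeries (Option ζ) ℚ)
          (MvPolynomial.X none - 1 : MvPolynomial (Option ζ) ℚ) ≠ 0 := by
        rw [Ne, FaithfulSMul.algebraMap_eq_zero_iff]
        exact hX.1
      refine (mul_eq_zero.1 ?_).resolve_left hX'
      rw [← Algebra.smul_def, Finset.smul_sum, ← hc, Finsupp.sum]
      refine Finset.sum_congr rfl fun n _ => ?_
      rw [smul_smul, ← hf n]
  · push Not at hall
    obtain ⟨b, hb⟩ := hall
    refine isDFiniteIn_iff.2 ⟨c.mapRange (evalOne ζ) (map_zero _), ?_, ?_⟩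
    · intro h0
      exact hb (by simpa using DFunLike.congr_fun h0 b)
    · rw [Finsupp.sum_mapRange_index (by simp)]
      have hsum : ∀ s : Finset ℕ,
          HasAtOne (∑ n ∈ s, c n • (MvPowerSeries.pderiv ℚ (some z))^[n] F) ∧
          atOne (∑ n ∈ s, c n • (MvPowerSeries.pderiv ℚ (some z))^[n] F) =
            ∑ n ∈ s, evalOne ζ (c n) • (MvPowerSeries.pderiv ℚ z)^[n] (atOne F) := by
        classical
        intro s
        induction s using Finset.induction_on with
        | empty => exact ⟨HasAtOne.zero, atOne_zero⟩
        | insert n s hn ihs =>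
          have h1 := atOne_pderiv_iterate hF z n
          have h2 := atOne_smul (c n) h1.1
          simp only [Finset.sum_insert hn]
          exact ⟨h2.1.add ihs.1, by rw [atOne_add h2.1 ihs.1, h2.2, ihs.2, h1.2]⟩
      have h1 := (hsum c.support).2
      rw [Finsupp.sum] at hc
      rw [hc, atOne_zero] at h1
      exact h1.symm

end Diagonal

/-! ### Walks of Hadamard models -/

namespace HadamardWalk

/-- All points visited by the walk with steps `w` starting at `p` have non-negative coordinates. -/
def Confined {n : ℕ} (p : Fin n → ℤ) (w : List (Fin n → ℤ)) : Prop :=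
  ∀ q : List (Fin n → ℤ), q <+: w → 0 ≤ p + q.sum

theorem isOrthantWalk_iff {n : ℕ} {S : Finset (Fin n → ℤ)} {w : List (Fin n → ℤ)} :
    IsOrthantWalk S w ↔ (∀ s ∈ w, s ∈ S) ∧ Confined 0 w := by
  simp [IsOrthantWalk, Confined, Pi.le_def]

theorem confined_nil {n : ℕ} {p : Fin n → ℤ} : Confined p [] ↔ 0 ≤ p := by
  simp [Confined]

theorem confined_cons {n : ℕ} {p s : Fin n → ℤ} {w : List (Fin n → ℤ)} :
    Confined p (s :: w) ↔ 0 ≤ p ∧ Confined (p + s) w := by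
  constructor
  · refine fun h => ⟨by simpa using h [] List.nil_prefix, fun q hq => ?_⟩
    simpa [add_assoc] using h (s :: q) (List.cons_prefix_cons.2 ⟨rfl, hq⟩)
  · rintro ⟨h0, h⟩ q hq
    rcases q with _ | ⟨t, q⟩
    · simpa using h0
    · obtain ⟨rfl, hqw⟩ := List.cons_prefix_cons.1 hq
      simpa [add_assoc] using h q hqw

theorem Confined.nonneg {n : ℕ} {p : Fin n → ℤ} {w : List (Fin n → ℤ)} (h : Confined p w) :
    0 ≤ p := by
  simpa using h [] List.nil_prefix

variable {d δ : ℕ}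

/-- The first `d` coordinates. -/
def head : (Fin (d + δ) → ℤ) →+ (Fin d → ℤ) where
  toFun s i := s (Fin.castAdd δ i)
  map_zero' := rfl
  map_add' _ _ := rfl

/-- The last `δ` coordinates. -/
def tail : (Fin (d + δ) → ℤ) →+ (Fin δ → ℤ) where
  toFun s i := s (Fin.natAdd d i)
  map_zero' := rfl
  map_add' _ _ := rfl

theorem head_append (u : Fin d → ℤ) (t : Fin δ → ℤ) : head (Fin.append u t) = u := by
  ext i
  exact Fin.append_left u t i

theorem tail_append (u : Fin d → ℤ) (t : Fin δ → ℤ) : tail (Fin.append u t) = t := by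
  ext i
  exact Fin.append_right u t i

theorem append_head_tail (s : Fin (d + δ) → ℤ) : Fin.append (head s) (tail s) = s :=
  Fin.append_castAdd_natAdd

theorem nonneg_iff (s : Fin (d + δ) → ℤ) : 0 ≤ s ↔ 0 ≤ head s ∧ 0 ≤ tail s := by
  refine ⟨fun h => ⟨fun i => h _, fun i => h _⟩, fun h i => ?_⟩
  refine Fin.addCases (fun i => h.1 i) (fun i => h.2 i) i

/-- The coloured walk formed by the first `d` coordinates: a step is black if the last `δ`
coordinates change. -/
def coloured (w : List (Fin (d + δ) → ℤ)) : List ((Fin d → ℤ) × Bool) :=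
  w.map fun s => (head s, decide (tail s ≠ 0))

/-- The walk formed by the last `δ` coordinates, with stationary steps removed. -/
def moving (w : List (Fin (d + δ) → ℤ)) : List (Fin δ → ℤ) :=
  (w.map tail).filter (· ≠ 0)

/-- Reconstruction of a walk: the black steps of `c` are combined with the steps of `τ`. -/
def merge : List ((Fin d → ℤ) × Bool) → List (Fin δ → ℤ) → List (Fin (d + δ) → ℤ)
  | [], _ => []
  | (u, false) :: c, τ => Fin.append u 0 :: merge c τ
  -- A default value, not reached when the number of black steps is the length of the second walk.
  | (u, true) :: c, [] => Fin.append u 0 :: merge c []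
  | (u, true) :: c, t :: τ => Fin.append u t :: merge c τ

theorem merge_coloured_moving (w : List (Fin (d + δ) → ℤ)) :
    merge (coloured w) (moving w) = w := by
  induction w with
  | nil => rfl
  | cons s w ih =>
    by_cases h : tail s = 0
    · have h1 : coloured (s :: w) = (head s, false) :: coloured w := by simp [coloured, h]
      have h2 : moving (s :: w) = moving w := by simp [moving, h]
      rw [h1, h2, merge, ih, ← h, append_head_tail]
    · have h1 : coloured (s :: w) = (head s, true) :: coloured w := by simp [coloured, h]
      have h2 : moving (s :: w) = tail s :: moving w := by simp [moving, h]
      rw [h1, h2, merge, ih, append_head_tail]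

theorem coloured_merge {c : List ((Fin d → ℤ) × Bool)} {τ : List (Fin δ → ℤ)}
    (h0 : ∀ t ∈ τ, t ≠ 0) (h : c.countP Prod.snd = τ.length) :
    coloured (merge c τ) = c ∧ moving (merge c τ) = τ := by
  induction c generalizing τ with
  | nil =>
    obtain rfl : τ = [] := List.length_eq_zero_iff.1 (by simpa using h.symm)
    exact ⟨rfl, rfl⟩
  | cons s c ih =>
    obtain ⟨u, b⟩ := s
    rcases b with _ | _
    · obtain ⟨h1, h2⟩ := ih h0 (by simpa using h)
      constructor
      · rw [merge, coloured, List.map_cons, tail_append, head_append, ← coloured, h1]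
        simp
      · rw [merge, moving, List.map_cons, tail_append, List.filter_cons_of_neg (by simp), ← moving,
          h2]
    · rcases τ with _ | ⟨t, τ⟩
      · simp at h
      · obtain ⟨h1, h2⟩ := ih (fun x hx => h0 x (List.mem_cons_of_mem _ hx)) (by simpa using h)
        have ht := h0 t List.mem_cons_self
        constructor
        · rw [merge, coloured, List.map_cons, tail_append, head_append, ← coloured, h1]
          simp [ht]
        · rw [merge, moving, List.map_cons, tail_append, List.filter_cons_of_pos (by simpa using ht),
            ← moving, h2]

theorem map_fst_coloured (w : List (Fin (d + δ) → ℤ)) :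
    (coloured w).map Prod.fst = w.map head := by
  simp [coloured, Function.comp_def]

theorem length_coloured (w : List (Fin (d + δ) → ℤ)) : (coloured w).length = w.length :=
  List.length_map ..

theorem countP_coloured (w : List (Fin (d + δ) → ℤ)) :
    (coloured w).countP Prod.snd = (moving w).length := by
  rw [coloured, moving, List.countP_map, ← List.countP_eq_length_filter, List.countP_map]
  rfl

theorem sum_moving (w : List (Fin (d + δ) → ℤ)) : (moving w).sum = tail w.sum := by
  induction w with
  | nil => simp [moving]
  | cons s w ih =>
    by_cases h : tail s = 0
    · have h2 : moving (s :: w) = moving w := by simp [moving, h]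
      rw [h2, ih, List.sum_cons, map_add, h, zero_add]
    · have h2 : moving (s :: w) = tail s :: moving w := by simp [moving, h]
      rw [h2, List.sum_cons, ih, List.sum_cons, map_add]

/-- Steps that fix the last coordinates add no new points to their projection, so they can be
deleted. The starting point is arbitrary for the sake of the induction. -/
theorem confined_iff (p : Fin (d + δ) → ℤ) (w : List (Fin (d + δ) → ℤ)) :
    Confined p w ↔ Confined (head p) (w.map head) ∧ Confined (tail p) (moving w) := by
  induction w generalizing p with
  | nil => simp [moving, confined_nil, nonneg_iff]
  | cons s w ih =>
    rw [confined_cons, ih, List.map_cons, confined_cons, nonneg_iff, map_add, map_add]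
    by_cases h : tail s = 0
    · have h2 : moving (s :: w) = moving w := by simp [moving, h]
      rw [h2, h, add_zero]
      exact ⟨fun h => ⟨⟨h.1.1, h.2.1⟩, h.2.2⟩, fun h => ⟨⟨h.1.1, h.2.nonneg⟩, h.1.2, h.2⟩⟩
    · have h2 : moving (s :: w) = tail s :: moving w := by simp [moving, h]
      rw [h2, confined_cons]
      tauto

variable {S : Finset (Fin (d + δ) → ℤ)} {U V : Finset (Fin d → ℤ)} {T : Finset (Fin δ → ℤ)}

theorem mem_iff (hS : IsHadamardModel S U V T) (s : Fin (d + δ) → ℤ) :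
    s ∈ S ↔ (head s ∈ U ∧ tail s = 0) ∨ (head s ∈ V ∧ tail s ∈ T) := by
  rw [hS.eq_union, Finset.mem_union, Finset.mem_image₂, Finset.mem_image₂]
  refine or_congr ⟨?_, ?_⟩ ⟨?_, ?_⟩
  · rintro ⟨u, hu, t, ht, rfl⟩
    rw [head_append, tail_append]
    exact ⟨hu, Finset.mem_singleton.1 ht⟩
  · rintro ⟨h1, h2⟩
    exact ⟨_, h1, _, Finset.mem_singleton.2 h2, append_head_tail s⟩
  · rintro ⟨u, hu, t, ht, rfl⟩
    rw [head_append, tail_append]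
    exact ⟨hu, ht⟩
  · rintro ⟨h1, h2⟩
    exact ⟨_, h1, _, h2, append_head_tail s⟩

/-- The colour of a step records which part of `S` it comes from: white for `U × {0}`, black for `V
× T`. These parts are disjoint because `0 ∉ T`, and the colouring rules exclude the wrong colour
when the first block lies in only one of `U` and `V`. -/
theorem steps_iff (hS : IsHadamardModel S U V T) (w : List (Fin (d + δ) → ℤ)) :
    (∀ s ∈ w, s ∈ S) ↔ ((∀ u ∈ w.map head, u ∈ U ∪ V) ∧
      ∀ s ∈ coloured w, (s.1 ∈ U \ V → s.2 = false) ∧ (s.1 ∈ V \ U → s.2 = true)) ∧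
      ∀ t ∈ moving w, t ∈ T := by
  have hfilter : (∀ t ∈ moving w, t ∈ T) ↔ ∀ s ∈ w, tail s ≠ 0 → tail s ∈ T := by
    simp only [moving, List.forall_mem_filter, List.forall_mem_map, decide_eq_true_eq]
  rw [hfilter, coloured, List.forall_mem_map, List.forall_mem_map, ← forall₂_and, ← forall₂_and]
  refine forall₂_congr fun s _ => ?_
  rw [mem_iff hS, Finset.mem_union, Finset.mem_sdiff, Finset.mem_sdiff, decide_eq_true_eq,
    decide_eq_false_iff_not]
  have hT : tail s = 0 → tail s ∉ T := fun h => h ▸ hS.zero_notMem_T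
  tauto

theorem isOrthantWalk_iff_coloured (hS : IsHadamardModel S U V T) (w : List (Fin (d + δ) → ℤ)) :
    IsOrthantWalk S w ↔ IsColouredWalk U V (coloured w) ∧ IsOrthantWalk T (moving w) := by
  rw [IsColouredWalk, isOrthantWalk_iff, isOrthantWalk_iff, isOrthantWalk_iff, steps_iff hS,
    confined_iff, map_fst_coloured, map_zero, map_zero]
  tauto

/-- The decomposition of walks with `k` moving steps is a bijection. -/
theorem ncard_walks (hS : IsHadamardModel S U V T) (n k : ℕ) (e : Fin (d + δ) → ℤ) :
    {w : List (Fin (d + δ) → ℤ) | (IsOrthantWalk S w ∧ w.length = n ∧ w.sum = e) ∧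
      (moving w).length = k}.ncard =
    {c : List ((Fin d → ℤ) × Bool) | IsColouredWalk U V c ∧ c.countP Prod.snd = k ∧
      c.length = n ∧ (c.map Prod.fst).sum = head e}.ncard *
    {τ : List (Fin δ → ℤ) | IsOrthantWalk T τ ∧ τ.length = k ∧ τ.sum = tail e}.ncard := by
  rw [← Set.ncard_prod]
  refine Set.ncard_congr (fun w _ => (coloured w, moving w)) ?_ ?_ ?_
  · rintro w ⟨⟨hw, hn, rfl⟩, hk⟩
    obtain ⟨h1, h2⟩ := (isOrthantWalk_iff_coloured hS w).1 hw
    refine ⟨⟨h1, ?_, ?_, ?_⟩, h2, hk, sum_moving w⟩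
    · rw [countP_coloured, hk]
    · rw [length_coloured, hn]
    · rw [map_fst_coloured, map_list_sum]
  · intro w w' _ _ h
    rw [Prod.mk.injEq] at h
    rw [← merge_coloured_moving w, h.1, h.2, merge_coloured_moving]
  · rintro ⟨c, τ⟩ ⟨⟨hc, hck, hcn, hce⟩, hτ, hτk, hτe⟩
    obtain ⟨h1, h2⟩ := coloured_merge (c := c) (τ := τ)
      (fun t ht h0 => hS.zero_notMem_T (h0 ▸ hτ.1 t ht)) (hck.trans hτk.symm)
    refine ⟨merge c τ, ⟨⟨?_, ?_, ?_⟩, by rw [h2]; exact hτk⟩, by rw [h1, h2]⟩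
    · rw [isOrthantWalk_iff_coloured hS, h1, h2]
      exact ⟨hc, hτ⟩
    · rw [← length_coloured, h1]
      exact hcn
    · rw [← append_head_tail (merge c τ).sum, ← append_head_tail e, ← sum_moving, h2, map_list_sum,
        ← map_fst_coloured, h1]
      exact congrArg₂ _ hce hτe

theorem ncard_walks_eq_sum (hS : IsHadamardModel S U V T) (n : ℕ) (e : Fin (d + δ) → ℤ) :
    {w : List (Fin (d + δ) → ℤ) | IsOrthantWalk S w ∧ w.length = n ∧ w.sum = e}.ncard =
    ∑ k ∈ Finset.range (n + 1),
      {c : List ((Fin d → ℤ) × Bool) | IsColouredWalk U V c ∧ c.countP Prod.snd = k ∧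
        c.length = n ∧ (c.map Prod.fst).sum = head e}.ncard *
      {τ : List (Fin δ → ℤ) | IsOrthantWalk T τ ∧ τ.length = k ∧ τ.sum = tail e}.ncard := by
  classical
  have hfin : {w : List (Fin (d + δ) → ℤ) | IsOrthantWalk S w ∧ w.length = n ∧ w.sum = e}.Finite :=
    (finite_walks S n).subset fun w hw => ⟨hw.1.1, hw.2.1⟩
  rw [Set.ncard_eq_toFinset_card _ hfin,
    Finset.card_eq_sum_card_fiberwise (f := fun w => (moving w).length)
      (t := Finset.range (n + 1))]
  · refine Finset.sum_congr rfl fun k _ => ?_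
    rw [← ncard_walks hS, ← Set.ncard_coe_finset]
    congr 1
    ext w
    simp
  · intro w hw
    have hn : w.length = n := by simpa using ((hfin.mem_toFinset).1 hw).2.1
    -- There are at most `n` moving steps, so the classes `k ≤ n` exhaust the walks.
    have h := (List.length_filter_le (· ≠ 0) (w.map (tail (d := d) (δ := δ))))
    rw [List.length_map, hn] at h
    simp only [Finset.coe_range, Set.mem_Iio]
    exact Nat.lt_succ_of_le h

/-- There are no coloured walks with more black steps than steps. -/
theorem ncard_coloured_eq_zero {n k : ℕ} (h : n < k) (e : Fin d → ℤ) :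
    {c : List ((Fin d → ℤ) × Bool) | IsColouredWalk U V c ∧ c.countP Prod.snd = k ∧
        c.length = n ∧ (c.map Prod.fst).sum = e}.ncard = 0 := by
  convert Set.ncard_empty (List ((Fin d → ℤ) × Bool))
  refine Set.eq_empty_of_forall_notMem fun c hc => ?_
  have := List.countP_le_length (p := Prod.snd) (l := c)
  rw [hc.2.1, hc.2.2.1] at this
  omega

end HadamardWalk

/-! ### Products of series in disjoint sets of variables -/

/-- A monomial in a disjoint union of two sets of variables factors in exactly one way, so the
convolution has a single relevant term. -/
theorem MvPowerSeries.coeff_rename_mul_rename {α β σ : Type} (f : α ↪ σ) (g : β ↪ σ)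
    (hfg : ∀ a b, f a ≠ g b) (hcover : ∀ s, s ∈ Set.range f ∨ s ∈ Set.range g)
    (F : MvPowerSeries α ℚ) (G : MvPowerSeries β ℚ) (m : σ →₀ ℕ) :
    coeff m (rename f F * rename g G) =
      coeff (m.comapDomain f f.injective.injOn) F * coeff (m.comapDomain g g.injective.injOn) G := by
  classical
  set a := m.comapDomain f f.injective.injOn with ha
  set b := m.comapDomain g g.injective.injOn with hb
  have hg : ∀ i, f i ∉ Set.range g := fun i ⟨j, hj⟩ => hfg i j hj.symm
  have hf : ∀ j, g j ∉ Set.range f := fun j ⟨i, hi⟩ => hfg i j hi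
  have hm : a.embDomain f + b.embDomain g = m := by
    ext s
    rcases hcover s with ⟨i, rfl⟩ | ⟨j, rfl⟩
    · rw [Finsupp.add_apply, Finsupp.embDomain_apply_self,
        Finsupp.embDomain_of_notMem_range _ _ _ (hg i)]
      simp [ha]
    · rw [Finsupp.add_apply, Finsupp.embDomain_apply_self,
        Finsupp.embDomain_of_notMem_range _ _ _ (hf j)]
      simp [hb]
  rw [coeff_mul, Finset.sum_eq_single (a.embDomain f, b.embDomain g)]
  · rw [coeff_embDomain_rename, coeff_embDomain_rename]
  · rintro ⟨x, y⟩ hxy hne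
    rw [Finset.HasAntidiagonal.mem_antidiagonal] at hxy
    by_contra h0
    obtain ⟨hx, hy⟩ := ne_zero_and_ne_zero_of_mul h0
    have hx' : x ∈ Set.range (Finsupp.mapDomain f) := by
      by_contra h
      exact hx (coeff_rename_eq_zero _ _ h)
    have hy' : y ∈ Set.range (Finsupp.mapDomain g) := by
      by_contra h
      exact hy (coeff_rename_eq_zero _ _ h)
    obtain ⟨a', rfl⟩ := hx'
    obtain ⟨b', rfl⟩ := hy'
    rw [← Finsupp.embDomain_eq_mapDomain, ← Finsupp.embDomain_eq_mapDomain] at hxy hne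
    refine hne ?_
    congr 2
    · ext i
      have h := DFunLike.congr_fun hxy (f i)
      rw [Finsupp.add_apply, Finsupp.embDomain_apply_self,
        Finsupp.embDomain_of_notMem_range _ _ _ (hg i), add_zero] at h
      exact h
    · ext j
      have h := DFunLike.congr_fun hxy (g j)
      rw [Finsupp.add_apply, Finsupp.embDomain_apply_self,
        Finsupp.embDomain_of_notMem_range _ _ _ (hf j), zero_add] at h
      exact h
  · intro h
    exact absurd (Finset.HasAntidiagonal.mem_antidiagonal.2 hm) h

/-! ### The generating functions of a Hadamard model -/

variable {d δ : ℕ}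

theorem coeff_coeff_hadamardProd (U V : Finset (Fin d → ℤ)) (T : Finset (Fin δ → ℤ)) (k : ℕ)
    (m : Option (Fin (d + δ)) →₀ ℕ) :
    coeff m (PowerSeries.coeff k (hadamardProd (colouredSeriesInV δ U V) (walkSeriesInV d T))) =
      coeff ((m.comapDomain (Fin.castAddEmb (n := d) δ).optionMap
        (Fin.castAddEmb (n := d) δ).optionMap.injective.injOn).optionElim k) (colouredSeries U V) *
      coeff ((m.comapDomain ((Fin.natAddEmb (m := δ) d).trans Function.Embedding.some)
        ((Fin.natAddEmb (m := δ) d).trans Function.Embedding.some).injective.injOn).optionElim k)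
        (walkSeries T) := by
  rw [hadamardProd, PowerSeries.coeff_mk, colouredSeriesInV, walkSeriesInV, PowerSeries.coeff_map,
    PowerSeries.coeff_map]
  refine (coeff_rename_mul_rename _ _ ?_ ?_ _ _ m).trans ?_
  · rintro (_ | i) j
    · simp
    · simp [Fin.ext_iff]
      omega
  · rintro (_ | s)
    · exact Or.inl ⟨none, rfl⟩
    · refine Fin.addCases (fun i => Or.inl ⟨some i, rfl⟩) (fun j => Or.inr ⟨j, rfl⟩) s
  · rw [coeff_coeff_optionEquivLeft, coeff_coeff_optionEquivLeft]

/-- The variables `v`, `t` and `x₁, …, x_d` of the series of coloured walks, among all variables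
and two copies of the variable `v`. -/
def colouredEmb (d δ : ℕ) : Option (Option (Fin d)) ↪ Option (Option (Option (Fin (d + δ)))) :=
  ((Fin.castAddEmb (n := d) δ).optionMap.optionMap).trans Function.Embedding.some

/-- The variables `v` and `x_{d+1}, …, x_{d+δ}` of the series of walks with steps in `T`, among all
variables and two copies of the variable `v`. -/
def movingEmb (d δ : ℕ) : Option (Fin δ) ↪ Option (Option (Option (Fin (d + δ)))) :=
  ((Fin.natAddEmb (m := δ) d).trans
    (Function.Embedding.some.trans Function.Embedding.some)).optionMap

/-- With separate copies of `v`, the two series share no variable. Equating the two exponents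
multiplies coefficients of the same `vᵏ`, which is the Hadamard product. -/
theorem optionEquivLeft_diag (U V : Finset (Fin d → ℤ)) (T : Finset (Fin δ → ℤ)) :
    optionEquivLeft (Option (Fin (d + δ))) ℚ (Diagonal.diag
      (rename (colouredEmb d δ) (colouredSeries U V) * rename (movingEmb d δ) (walkSeries T))) =
      hadamardProd (colouredSeriesInV δ U V) (walkSeriesInV d T) := by
  ext k m
  rw [coeff_coeff_optionEquivLeft, Diagonal.coeff_diag, coeff_coeff_hadamardProd,
    coeff_rename_mul_rename]
  · congr 3
    · ext o
      rcases o with _ | _ | i <;> simp [colouredEmb]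
    · ext o
      rcases o with _ | j <;> simp [movingEmb]
  · rintro (_ | _ | i) (_ | j)
    · simp [colouredEmb, movingEmb]
    · simp [colouredEmb, movingEmb]
    · simp [colouredEmb, movingEmb]
    · simp [colouredEmb, movingEmb]
    · simp [colouredEmb, movingEmb]
    · simp [colouredEmb, movingEmb, Fin.ext_iff]
      omega
  · rintro (_ | _ | _ | s)
    · exact Or.inr ⟨none, rfl⟩
    · exact Or.inl ⟨none, rfl⟩
    · exact Or.inl ⟨some none, rfl⟩
    · refine Fin.addCases (fun i => Or.inl ⟨some (some i), rfl⟩)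
        (fun j => Or.inr ⟨some j, rfl⟩) s

/-! ### Coefficients as numbers of walks -/

section Coefficients

variable (U V : Finset (Fin d → ℤ)) (T : Finset (Fin δ → ℤ))

theorem coeff_coloured (k : ℕ) (m : Option (Fin (d + δ)) →₀ ℕ) :
    coeff ((m.comapDomain (Fin.castAddEmb (n := d) δ).optionMap
        (Fin.castAddEmb (n := d) δ).optionMap.injective.injOn).optionElim k)
        (colouredSeries U V) =
      ({c : List ((Fin d → ℤ) × Bool) | IsColouredWalk U V c ∧ c.countP Prod.snd = k ∧
        c.length = m none ∧
        (c.map Prod.fst).sum = HadamardWalk.head fun i : Fin (d + δ) => (m (some i) : ℤ)}.ncard :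
        ℚ) := by
  simp only [coeff_apply, colouredSeries, funext_iff, Finsupp.optionElim_apply_none,
    Finsupp.optionElim_apply_some, Finsupp.comapDomain_apply]
  rfl

theorem coeff_walk (k : ℕ) (m : Option (Fin (d + δ)) →₀ ℕ) :
    coeff ((m.comapDomain ((Fin.natAddEmb (m := δ) d).trans Function.Embedding.some)
        ((Fin.natAddEmb (m := δ) d).trans Function.Embedding.some).injective.injOn).optionElim k)
        (walkSeries T) =
      ({τ : List (Fin δ → ℤ) | IsOrthantWalk T τ ∧ τ.length = k ∧
        τ.sum = HadamardWalk.tail fun i : Fin (d + δ) => (m (some i) : ℤ)}.ncard : ℚ) := by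
  simp only [coeff_apply, walkSeries, funext_iff, Finsupp.optionElim_apply_none,
    Finsupp.optionElim_apply_some, Finsupp.comapDomain_apply]
  rfl

end Coefficients

/-! ### Specialisation of the Hadamard product, and the theorem -/

theorem coeff_hadamardProd_eq_zero (U V : Finset (Fin d → ℤ)) (T : Finset (Fin δ → ℤ)) {k : ℕ}
    {m : Option (Fin (d + δ)) →₀ ℕ} (h : m none < k) :
    coeff m (PowerSeries.coeff k (hadamardProd (colouredSeriesInV δ U V) (walkSeriesInV d T))) =
      0 := by
  rw [coeff_coeff_hadamardProd, coeff_coloured, HadamardWalk.ncard_coloured_eq_zero h]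
  simp

theorem canSpecialiseAtOne_hadamardProd (U V : Finset (Fin d → ℤ)) (T : Finset (Fin δ → ℤ)) :
    CanSpecialiseAtOne (hadamardProd (colouredSeriesInV δ U V) (walkSeriesInV d T)) := fun m =>
  (Set.finite_Iic (m none)).subset fun k hk => by
    by_contra h
    exact hk (coeff_hadamardProd_eq_zero U V T (not_le.1 h))

theorem walkSeries_eq_specialiseAtOne {S : Finset (Fin (d + δ) → ℤ)} {U V : Finset (Fin d → ℤ)}
    {T : Finset (Fin δ → ℤ)} (hS : IsHadamardModel S U V T) :
    walkSeries S =
      specialiseAtOne (hadamardProd (colouredSeriesInV δ U V) (walkSeriesInV d T)) := by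
  ext m
  have h1 : coeff m (specialiseAtOne (hadamardProd (colouredSeriesInV δ U V)
      (walkSeriesInV d T))) = ∑ᶠ k : ℕ, coeff m (PowerSeries.coeff k
        (hadamardProd (colouredSeriesInV δ U V) (walkSeriesInV d T))) := rfl
  have h2 : coeff m (walkSeries S) = ({w : List (Fin (d + δ) → ℤ) | IsOrthantWalk S w ∧
      w.length = m none ∧ w.sum = fun i : Fin (d + δ) => (m (some i) : ℤ)}.ncard : ℚ) := by
    simp only [coeff_apply, walkSeries, funext_iff]
  rw [h1, h2, HadamardWalk.ncard_walks_eq_sum hS,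
    finsum_eq_sum_of_support_subset (s := Finset.range (m none + 1))]
  · push_cast
    refine Finset.sum_congr rfl fun k _ => ?_
    rw [coeff_coeff_hadamardProd, coeff_coloured, coeff_walk]
  · intro k hk
    simp only [Finset.coe_range, Set.mem_Iio]
    by_contra h
    exact hk (coeff_hadamardProd_eq_zero U V T (by omega))

theorem isDFinite_walkSeries {S : Finset (Fin (d + δ) → ℤ)} {U V : Finset (Fin d → ℤ)}
    {T : Finset (Fin δ → ℤ)} (hS : IsHadamardModel S U V T) (h1 : IsDFinite (colouredSeries U V))
    (h2 : IsDFinite (walkSeries T)) : IsDFinite (walkSeries S) := by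
  intro z
  rw [walkSeries_eq_specialiseAtOne hS, ← optionEquivLeft_diag]
  -- The two last goals say that each factor omits the other's copy of `v`, as required for the
  -- diagonal.
  refine Diagonal.isDFiniteIn_atOne ?_ (Diagonal.isDFiniteIn_diag_mul z
    (h1.exists_finiteOrder_rename _) (h2.exists_finiteOrder_rename _)
    (pderiv_rename_of_notMem _ ?_ _) (pderiv_rename_of_notMem _ ?_ _))
  · rw [Diagonal.HasAtOne, optionEquivLeft_diag]
    exact canSpecialiseAtOne_hadamardProd U V T
  · rintro ⟨o, ho⟩
    simp [colouredEmb] at ho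
  · rintro ⟨_ | o, ho⟩ <;> simp [movingEmb] at ho

theorem mainTheorem1 {d δ : ℕ} (S : Finset (Fin (d + δ) → ℤ)) (U V : Finset (Fin d → ℤ))
    (T : Finset (Fin δ → ℤ)) (hS : IsHadamardModel S U V T) :
    (CanSpecialiseAtOne (hadamardProd (colouredSeriesInV δ U V) (walkSeriesInV d T)) ∧
      walkSeries S =
        specialiseAtOne (hadamardProd (colouredSeriesInV δ U V) (walkSeriesInV d T))) ∧
    (IsDFinite (colouredSeries U V) → IsDFinite (walkSeries T) → IsDFinite (walkSeries S)) :=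
  ⟨⟨canSpecialiseAtOne_hadamardProd U V T, walkSeries_eq_specialiseAtOne hS⟩,
    isDFinite_walkSeries hS⟩
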